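/- Identify $\mathbb{R}^2$ with $\mathbb{C}$. Let $\mu$ be a probability measure with finite support on the group of orientation-preserving isometries of $\mathbb{R}^2$; such an isometry has the form $g(x)=e^{i\theta(g)}x+g(0)$, where $\theta(g)\in\mathbb{R}/2\pi\mathbb{Z}$ is its angle of rotation. Let $g_1,g_2,\dots$ be independent with law $\mu$ and put $Y_N=(g_1g_2\cdots g_N)(0)$. For $m>0$, say that an angle $\theta$ satisfies (D.C.-$m$) if there is $q_0$ such that $|\theta-2\pi p/q|\ge q^{-m}$ for all integers $p$ and all integers $q\ge q_0$. Suppose that $\mathbb{E}\,g_1(0)=0$ and that for some $m>0$ one of the following holds: 1. there are $h_1,h_2\in\operatorname{supp}\mu$ such that $\theta(h_1h_2^{-1})$ satisfies (D.C.-$m$); 2. there is $\theta_0$ satisfying (D.C.-$m$) such that $\theta(g)=\theta_0$ for all $g\in\operatorname{supp}\mu$. Then there is $c>0$ such that $Y_N$ satisfies a local central limit theorem to scale $e^{-c(\log N)^2}$, i.e. for each $N$ there is a Gaussian random variable $Z_N$ on $\mathbb{R}^2$ (possibly degenerate) such that $$|\mathbb{P}(Y_N\in B_r(x_0))-\mathbb{P}(Z_N\in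 B_r(x_0))|=o(N^{-1}r^2)\quad\text{as }N\to\infty,$$ uniformly in $x_0\in\mathbb{R}^2$ and $r>e^{-c(\log N)^2}$. More precisely, with $\sigma^2=\frac12\mathbb{E}|g_1(0)|^2$, $\sigma\ge0$, and $Z$ a standard Gaussian on $\mathbb{R}^2$, there is a constant $C>0$ such that for all integers $N\ge1$, all $x_0\in\mathbb{R}^2$ and all $r>e^{-c(\log N)^2}$, $$|\mathbb{P}(Y_N\in B_r(x_0))-\mathbb{P}(\sigma\sqrt N\,Z\in B_r(x_0))|\le C N^{-3/2}r^2.$$ -/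

import Mathlib

open MeasureTheory ProbabilityTheory Filter

/-- The isometry group of the plane `ℝ² = ℂ` carries the σ-algebra generated by the evaluations
`g ↦ g x`, i.e. the Borel σ-algebra of its usual topology (pointwise convergence). -/
noncomputable instance isomMeasurableSpace : MeasurableSpace (ℂ ≃ᵢ ℂ) :=
  MeasurableSpace.comap (fun (g : ℂ ≃ᵢ ℂ) (x : ℂ) => g x) MeasurableSpace.pi

/-- `g = τ_{g(0)} ∘ ρ_θ`: the isometry `g` is orientation preserving and `θ` is (a representative
modulo `2π` of) its angle of rotation `θ(g)`. -/
def HasRotationAngle (g : ℂ ≃ᵢ ℂ) (θ : ℝ) : Prop :=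
  ∀ x : ℂ, g x = Complex.exp (θ * Complex.I) * x + g 0

/-- The Diophantine condition with exponent `m`: `|θ - 2πp/q| ≥ q^{-m}` for all integers `p` and
all sufficiently large `q`. It is invariant under `θ ↦ θ + 2π`. -/
def DiophantineAngle (m θ : ℝ) : Prop :=
  ∃ q₀ : ℕ, ∀ q : ℕ, q₀ ≤ q → ∀ p : ℤ, (q : ℝ) ^ (-m) ≤ |θ - 2 * Real.pi * p / q|

/-- `Y_N = (g₁ g₂ ⋯ g_N)(0)`. -/
noncomputable def walkPoint (N : ℕ) (g : Fin N → (ℂ ≃ᵢ ℂ)) : ℂ :=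
  (List.ofFn g).prod 0

/-- `P(Y_N ∈ B)`, where `g₁, …, g_N` are independent with law `μ`. -/
noncomputable def walkProb (μ : PMF (ℂ ≃ᵢ ℂ)) (N : ℕ) (B : Set ℂ) : ℝ :=
  (Measure.pi fun _ : Fin N => μ.toMeasure).real {g | walkPoint N g ∈ B}

/-- `σ = (½ E|g₁(0)|²)^{1/2}`. -/
noncomputable def walkSigma (μ : PMF (ℂ ≃ᵢ ℂ)) : ℝ :=
  Real.sqrt ((1 / 2) * ∫ g, ‖g 0‖ ^ 2 ∂μ.toMeasure)

/-- The local central limit theorem to scale `δ_N`: there are Gaussian laws `γ_N` on the plane with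
`|P(Y_N ∈ B_r(x₀)) - γ_N(B_r(x₀))| = o(N⁻¹ r²)` uniformly in `x₀` and `r > δ_N`. -/
def LocalCLTToScale (μ : PMF (ℂ ≃ᵢ ℂ)) (δ : ℕ → ℝ) : Prop :=
  ∃ γ : ℕ → Measure ℂ, (∀ N, IsGaussian (γ N)) ∧
    ∀ ε : ℝ, 0 < ε → ∀ᶠ N : ℕ in atTop, ∀ (x₀ : ℂ) (r : ℝ), δ N < r →
      |walkProb μ N (Metric.ball x₀ r) - (γ N).real (Metric.ball x₀ r)| ≤ ε * ((N : ℝ)⁻¹ * r ^ 2)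

open scoped ComplexConjugate ENNReal FourierTransform Pointwise

/-!
Restricted to the circle of radius `R`, the characteristic function of `Y_N` is `T_R ^ N 1`, where
`T_R` averages, over the steps of the walk, a rotation of the circle followed by multiplication by
a unimodular character. Two words differing only by a commutator of two steps have the same angle
and distinct translation parts, and the Diophantine angle rotates this difference through a net of
directions that is only polynomially sparse. Hence `T_R` cannot nearly fix a function for long, and
for `1 ≤ R ≤ exp (c (log N)²)` its iterates decay faster than any power of `N`. For small `R` a
second-order expansion, corrected by a second harmonic which absorbs the anisotropy of a single
step, compares `T_R ^ N 1` with `exp (-σ² N R² / 2)`. Smoothing turns the resulting weighted `L¹`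
bound for characteristic functions into the bound for balls.
-/

/-! ### Iterates of a contraction -/

section Contraction

variable {E : Type*} [SeminormedAddCommGroup E] [NormedSpace ℝ E] {T : Module.End ℝ E}

lemma norm_pow_apply_le_of_le (hT : ∀ v, ‖T v‖ ≤ ‖v‖) {m n : ℕ} (hmn : m ≤ n) (v : E) :
    ‖(T ^ n) v‖ ≤ ‖(T ^ m) v‖ := by
  refine antitone_nat_of_succ_le (f := fun n => ‖(T ^ n) v‖) (fun n => ?_) hmn
  rw [pow_succ', Module.End.mul_apply]
  exact hT _

lemma norm_pow_apply_le (hT : ∀ v, ‖T v‖ ≤ ‖v‖) (n : ℕ) (v : E) : ‖(T ^ n) v‖ ≤ ‖v‖ :=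
  norm_pow_apply_le_of_le hT n.zero_le v

lemma norm_pow_mul_apply_sq_le_exp {δ : ℝ} {ℓ : ℕ}
    (hgap : ∀ v, δ * ‖v‖ ^ 2 ≤ ‖v‖ ^ 2 - ‖(T ^ ℓ) v‖ ^ 2) (j : ℕ) (v : E) :
    ‖(T ^ (ℓ * j)) v‖ ^ 2 ≤ Real.exp (-δ * j) * ‖v‖ ^ 2 := by
  induction j with
  | zero => simp
  | succ j ih =>
    calc ‖(T ^ (ℓ * (j + 1))) v‖ ^ 2 = ‖(T ^ ℓ) ((T ^ (ℓ * j)) v)‖ ^ 2 := by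
          rw [← Module.End.mul_apply, ← pow_add, mul_add_one, add_comm]
      _ ≤ (1 - δ) * ‖(T ^ (ℓ * j)) v‖ ^ 2 := by linarith [hgap ((T ^ (ℓ * j)) v)]
      _ ≤ Real.exp (-δ) * ‖(T ^ (ℓ * j)) v‖ ^ 2 := by gcongr; exact Real.one_sub_le_exp_neg δ
      _ ≤ Real.exp (-δ) * (Real.exp (-δ * j) * ‖v‖ ^ 2) := by gcongr
      _ = Real.exp (-δ * (j + 1 : ℕ)) * ‖v‖ ^ 2 := by
          rw [← mul_assoc, ← Real.exp_add]; push_cast; ring_nf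

lemma norm_pow_apply_sq_le_exp (hT : ∀ v, ‖T v‖ ≤ ‖v‖) {δ : ℝ} {ℓ : ℕ}
    (hgap : ∀ v, δ * ‖v‖ ^ 2 ≤ ‖v‖ ^ 2 - ‖(T ^ ℓ) v‖ ^ 2) (N : ℕ) (v : E) :
    ‖(T ^ N) v‖ ^ 2 ≤ Real.exp (-δ * (N / ℓ : ℕ)) * ‖v‖ ^ 2 :=
  (pow_le_pow_left₀ (norm_nonneg _)
    (norm_pow_apply_le_of_le hT (Nat.mul_div_le N ℓ) v) 2).trans
    (norm_pow_mul_apply_sq_le_exp hgap _ v)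

lemma norm_pow_apply_sub_pow_smul_le {C a s ε : ℝ} (hC : 0 ≤ C) (hs : 0 ≤ s) (hsa : s ≤ a)
    (hdecay : ∀ n v, ‖(T ^ n) v‖ ≤ C * a ^ n * ‖v‖) {w : E} (hw : ‖T w - s • w‖ ≤ ε) (N : ℕ) :
    ‖(T ^ N) w - s ^ N • w‖ ≤ N * (C * a ^ (N - 1) * ε) := by
  have ha : 0 ≤ a := hs.trans hsa
  have hε : 0 ≤ ε := (norm_nonneg _).trans hw
  induction N with
  | zero => simp
  | succ N ih =>
    have hsplit : (T ^ (N + 1)) w - s ^ (N + 1) • w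
        = (T ^ N) (T w - s • w) + s • ((T ^ N) w - s ^ N • w) := by
      rw [pow_succ, Module.End.mul_apply, map_sub, map_smul, smul_sub, smul_smul, ← pow_succ']
      abel
    have hpow : s * (N * (C * a ^ (N - 1) * ε)) ≤ N * (C * a ^ N * ε) := by
      rcases N with _ | N
      · simp
      · calc s * ((N + 1 : ℕ) * (C * a ^ N * ε)) ≤ a * ((N + 1 : ℕ) * (C * a ^ N * ε)) := by
              gcongr
          _ = (N + 1 : ℕ) * (C * a ^ (N + 1) * ε) := by ring
    calc ‖(T ^ (N + 1)) w - s ^ (N + 1) • w‖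
        ≤ ‖(T ^ N) (T w - s • w)‖ + s * ‖(T ^ N) w - s ^ N • w‖ := by
          rw [hsplit]
          refine (norm_add_le _ _).trans ?_
          rw [norm_smul, Real.norm_of_nonneg hs]
      _ ≤ C * a ^ N * ε + s * (N * (C * a ^ (N - 1) * ε)) := by
          gcongr
          exact (hdecay N _).trans (by gcongr)
      _ ≤ (N + 1 : ℕ) * (C * a ^ N * ε) := by push_cast; linarith

lemma norm_pow_apply_sub_pow_smul_le_of_add {C a s ε : ℝ} (hC : 0 ≤ C) (hs : 0 ≤ s) (hsa : s ≤ a)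
    (hdecay : ∀ n v, ‖(T ^ n) v‖ ≤ C * a ^ n * ‖v‖) {u k : E}
    (hw : ‖T (u + k) - s • (u + k)‖ ≤ ε) (N : ℕ) :
    ‖(T ^ N) u - s ^ N • u‖ ≤ N * (C * a ^ (N - 1) * ε) + (C + 1) * a ^ N * ‖k‖ := by
  have hsplit : (T ^ N) u - s ^ N • u
      = ((T ^ N) (u + k) - s ^ N • (u + k)) - (T ^ N) k + s ^ N • k := by
    rw [map_add, smul_add]
    abel
  rw [hsplit]
  calc _ ≤ ‖(T ^ N) (u + k) - s ^ N • (u + k)‖ + ‖(T ^ N) k‖ + ‖s ^ N • k‖ :=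
        (norm_add_le _ _).trans (add_le_add_left (norm_sub_le _ _) _)
    _ ≤ N * (C * a ^ (N - 1) * ε) + C * a ^ N * ‖k‖ + a ^ N * ‖k‖ := by
        rw [norm_smul, Real.norm_of_nonneg (pow_nonneg hs N)]
        gcongr
        · exact norm_pow_apply_sub_pow_smul_le hC hs hsa hdecay hw N
        · exact hdecay N k
    _ = _ := by ring

end Contraction

/-! ### Averages of isometries -/

section Average

variable {E : Type*} [SeminormedAddCommGroup E] [InnerProductSpace ℝ E]
  {ι : Type*} [Fintype ι] {p : ι → ℝ}

lemma sum_mul_norm_sub_sum_smul_sq (hp : ∑ i, p i = 1) (v : ι → E) :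
    ∑ i, p i * ‖v i - ∑ j, p j • v j‖ ^ 2 = ∑ i, p i * ‖v i‖ ^ 2 - ‖∑ j, p j • v j‖ ^ 2 := by
  set m := ∑ j, p j • v j with hm
  have hinner : ∑ i, p i * inner ℝ (v i) m = ‖m‖ ^ 2 := by
    rw [← real_inner_self_eq_norm_sq, hm, sum_inner, ← hm]
    simp only [real_inner_smul_left]
  calc ∑ i, p i * ‖v i - m‖ ^ 2
      = ∑ i, (p i * ‖v i‖ ^ 2 - 2 * (p i * inner ℝ (v i) m) + p i * ‖m‖ ^ 2) :=
        Finset.sum_congr rfl fun i _ => by rw [norm_sub_sq_real]; ring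
    _ = ∑ i, p i * ‖v i‖ ^ 2 - ‖m‖ ^ 2 := by
        rw [Finset.sum_add_distrib, Finset.sum_sub_distrib, ← Finset.mul_sum, hinner,
          ← Finset.sum_mul, hp]
        ring

/-- The average of the isometries `U i` with weights `p i`: the transfer operator of a random walk
whose steps act by the `U i`. -/
noncomputable def avgOp (p : ι → ℝ) (U : ι → E →ₗᵢ[ℝ] E) : Module.End ℝ E :=
  ∑ i, p i • (U i).toLinearMap

variable {U : ι → E →ₗᵢ[ℝ] E}

lemma avgOp_apply (v : E) : avgOp p U v = ∑ i, p i • U i v := by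
  simp [avgOp]

lemma norm_sum_smul_le_of_mem_stdSimplex (hp : p ∈ stdSimplex ℝ ι) {v : ι → E} {C : ℝ}
    (hv : ∀ i, ‖v i‖ ≤ C) : ‖∑ i, p i • v i‖ ≤ C := by
  have := (convex_closedBall (0 : E) C).sum_mem (fun i _ => hp.1 i) hp.2
    fun i _ => mem_closedBall_zero_iff.2 (hv i)
  exact mem_closedBall_zero_iff.1 this

lemma norm_avgOp_apply_le (hp : p ∈ stdSimplex ℝ ι) (v : E) : ‖avgOp p U v‖ ≤ ‖v‖ := by
  rw [avgOp_apply]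
  exact norm_sum_smul_le_of_mem_stdSimplex hp fun i => ((U i).norm_map v).le

lemma mul_norm_sub_avgOp_sq_le (hp : p ∈ stdSimplex ℝ ι) (v : E) (i : ι) :
    p i * ‖U i v - avgOp p U v‖ ^ 2 ≤ ‖v‖ ^ 2 - ‖avgOp p U v‖ ^ 2 := by
  have h := sum_mul_norm_sub_sum_smul_sq hp.2 fun i => U i v
  simp only [LinearIsometry.norm_map, ← Finset.sum_mul, hp.2, one_mul, ← avgOp_apply] at h
  rw [← h]
  exact Finset.single_le_sum (f := fun i => p i * ‖U i v - avgOp p U v‖ ^ 2)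
    (fun i _ => mul_nonneg (hp.1 i) (sq_nonneg _)) (Finset.mem_univ i)

lemma norm_word_apply_sub_avgOp_pow_le {n : ℕ} {W : E →ₗᵢ[ℝ] E} (hW : W ∈ Set.range U ^ n)
    {v : E} {ε : ℝ}
    (hε : ∀ j < n, ∀ i, ‖U i ((avgOp p U ^ j) v) - avgOp p U ((avgOp p U ^ j) v)‖ ≤ ε) :
    ‖W v - (avgOp p U ^ n) v‖ ≤ n * ε := by
  induction n generalizing W with
  | zero =>
    rw [pow_zero, Set.mem_one] at hW
    simp [hW]
  | succ n ih =>
    rw [pow_succ'] at hW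
    obtain ⟨_, ⟨i, rfl⟩, W, hW, rfl⟩ := hW
    rw [pow_succ', Module.End.mul_apply]
    calc ‖U i (W v) - avgOp p U ((avgOp p U ^ n) v)‖
        ≤ ‖U i (W v) - U i ((avgOp p U ^ n) v)‖
          + ‖U i ((avgOp p U ^ n) v) - avgOp p U ((avgOp p U ^ n) v)‖ :=
          norm_sub_le_norm_sub_add_norm_sub _ _ _
      _ ≤ n * ε + ε := by
          rw [← map_sub, LinearIsometry.norm_map]
          exact add_le_add (ih hW fun j hj => hε j (hj.trans n.lt_succ_self))
            (hε n n.lt_succ_self i)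
      _ = (n + 1 : ℕ) * ε := by push_cast; ring

lemma norm_word_sub_word_sq_le (hp : p ∈ stdSimplex ℝ ι) {c : ℝ} (hc : 0 < c)
    (hcp : ∀ i, c ≤ p i) {n ℓ : ℕ} (hn : n ≤ ℓ) {W W' : E →ₗᵢ[ℝ] E}
    (hW : W ∈ Set.range U ^ n) (hW' : W' ∈ Set.range U ^ n) (v : E) :
    ‖W v - W' v‖ ^ 2 ≤ 4 * ℓ ^ 2 * (‖v‖ ^ 2 - ‖(avgOp p U ^ ℓ) v‖ ^ 2) / c := by
  have hT := norm_avgOp_apply_le (U := U) hp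
  set T := avgOp p U
  set D := ‖v‖ ^ 2 - ‖(T ^ ℓ) v‖ ^ 2
  have hD : 0 ≤ D := sub_nonneg.2 (pow_le_pow_left₀ (norm_nonneg _) (norm_pow_apply_le hT ℓ v) 2)
  have hstep : ∀ j < n, ∀ i, ‖U i ((T ^ j) v) - T ((T ^ j) v)‖ ≤ √(D / c) := by
    refine fun j hj i => Real.le_sqrt_of_sq_le ((le_div_iff₀' hc).2 ?_)
    have hlate := norm_pow_apply_le_of_le hT (show j + 1 ≤ ℓ by omega) v
    rw [pow_succ' T j, Module.End.mul_apply] at hlate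
    calc c * ‖U i ((T ^ j) v) - T ((T ^ j) v)‖ ^ 2
        ≤ p i * ‖U i ((T ^ j) v) - T ((T ^ j) v)‖ ^ 2 := by gcongr; exact hcp i
      _ ≤ ‖(T ^ j) v‖ ^ 2 - ‖T ((T ^ j) v)‖ ^ 2 := mul_norm_sub_avgOp_sq_le hp _ i
      _ ≤ D := sub_le_sub (pow_le_pow_left₀ (norm_nonneg _) (norm_pow_apply_le hT j v) 2)
          (pow_le_pow_left₀ (norm_nonneg _) hlate 2)
  have hdist : ‖W v - W' v‖ ≤ 2 * ℓ * √(D / c) := by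
    calc ‖W v - W' v‖ ≤ ‖W v - (T ^ n) v‖ + ‖(T ^ n) v - W' v‖ :=
          norm_sub_le_norm_sub_add_norm_sub _ _ _
      _ ≤ n * √(D / c) + n * √(D / c) := by
          rw [norm_sub_rev ((T ^ n) v)]
          exact add_le_add (norm_word_apply_sub_avgOp_pow_le hW hstep)
            (norm_word_apply_sub_avgOp_pow_le hW' hstep)
      _ = 2 * n * √(D / c) := by ring
      _ ≤ 2 * ℓ * √(D / c) := by gcongr
  calc ‖W v - W' v‖ ^ 2 ≤ (2 * ℓ * √(D / c)) ^ 2 := pow_le_pow_left₀ (norm_nonneg _) hdist 2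
    _ = 4 * ℓ ^ 2 * D / c := by
        rw [mul_pow, Real.sq_sqrt (by positivity)]
        ring

end Average

/-! ### The circle and the action of rigid motions on it -/

local notation "𝕋" => AddCircle (2 * Real.pi)

instance fact_two_pi_pos : Fact (0 < 2 * Real.pi) := ⟨Real.two_pi_pos⟩

lemma integrable_haarAddCircle_of_continuous {f : 𝕋 → ℝ} (hf : Continuous f) :
    Integrable f AddCircle.haarAddCircle :=
  hf.integrable_of_hasCompactSupport (HasCompactSupport.of_compactSpace f)

/-- Continuous functions on the circle with the inner product of `L²` for the Haar probability
measure. The space is not completed, so that its elements can be evaluated at points. -/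
def CircleL2 : Type := C(𝕋, ℂ)

namespace CircleL2

noncomputable instance : AddCommGroup CircleL2 := inferInstanceAs (AddCommGroup C(𝕋, ℂ))

noncomputable instance : Module ℝ CircleL2 := inferInstanceAs (Module ℝ C(𝕋, ℂ))

noncomputable instance : One CircleL2 := inferInstanceAs (One C(𝕋, ℂ))

instance : FunLike CircleL2 𝕋 ℂ := inferInstanceAs (FunLike C(𝕋, ℂ) 𝕋 ℂ)

instance : ContinuousMapClass CircleL2 𝕋 ℂ := inferInstanceAs (ContinuousMapClass C(𝕋, ℂ) 𝕋 ℂ)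

@[ext]
lemma ext {F G : CircleL2} (h : ∀ x, F x = G x) : F = G := DFunLike.ext F G h

@[simp]
lemma add_apply (F G : CircleL2) (x : 𝕋) : (F + G) x = F x + G x := rfl

@[simp]
lemma sub_apply (F G : CircleL2) (x : 𝕋) : (F - G) x = F x - G x := rfl

@[simp]
lemma smul_apply (c : ℝ) (F : CircleL2) (x : 𝕋) : (c • F) x = c • F x := rfl

@[simp]
lemma one_apply (x : 𝕋) : (1 : CircleL2) x = 1 := rfl

lemma sum_apply {ι : Type*} (s : Finset ι) (F : ι → CircleL2) (x : 𝕋) :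
    (∑ i ∈ s, F i) x = ∑ i ∈ s, F i x :=
  ContinuousMap.sum_apply (f := F) (s := s) x

/-- The class of a continuous function in the Hilbert space `L²`. -/
noncomputable def toLp : CircleL2 →ₗ[ℝ] Lp ℂ 2 (AddCircle.haarAddCircle : Measure 𝕋) :=
  (ContinuousMap.toLp (E := ℂ) 2 (AddCircle.haarAddCircle : Measure 𝕋) ℝ).toLinearMap

noncomputable instance : SeminormedAddCommGroup CircleL2 :=
  SeminormedAddCommGroup.induced CircleL2 _ toLp

noncomputable instance : InnerProductSpace ℝ CircleL2 where
  norm_smul_le c F := (congrArg norm (toLp.map_smul c F)).le.trans (norm_smul_le c (toLp F))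
  inner F G := inner ℝ (toLp F) (toLp G)
  norm_sq_eq_re_inner F := norm_sq_eq_re_inner (toLp F)
  conj_inner_symm F G := inner_conj_symm (toLp F) (toLp G)
  add_left F G H := by rw [map_add, inner_add_left]
  smul_left F G c := by rw [map_smul, inner_smul_left]

lemma norm_sq_eq_integral (F : CircleL2) :
    ‖F‖ ^ 2 = ∫ x, ‖F x‖ ^ 2 ∂AddCircle.haarAddCircle := by
  have h := ContinuousMap.inner_toLp (𝕜 := ℂ) (AddCircle.haarAddCircle : Measure 𝕋) F F
  rw [inner_self_eq_norm_sq_to_K] at h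
  simp_rw [Complex.mul_conj'] at h
  norm_cast at h
  exact Complex.ofReal_injective h

lemma norm_le_of_forall_norm_le {F : CircleL2} {M : ℝ} (h : ∀ x, ‖F x‖ ≤ M) : ‖F‖ ≤ M := by
  refine le_of_sq_le_sq ?_ ((norm_nonneg _).trans (h 0))
  calc ‖F‖ ^ 2 = ∫ x, ‖F x‖ ^ 2 ∂AddCircle.haarAddCircle := norm_sq_eq_integral F
    _ ≤ ∫ _x : 𝕋, M ^ 2 ∂AddCircle.haarAddCircle :=
      integral_mono (integrable_haarAddCircle_of_continuous (by fun_prop)) (integrable_const _)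
        fun x => pow_le_pow_left₀ (norm_nonneg _) (h x) 2
    _ = M ^ 2 := by simp

lemma integral_norm_le_norm (F : CircleL2) : ∫ x, ‖F x‖ ∂AddCircle.haarAddCircle ≤ ‖F‖ := by
  refine le_of_sq_le_sq ?_ (norm_nonneg _)
  rw [norm_sq_eq_integral]
  exact (even_two.convexOn_pow (𝕜 := ℝ)).map_integral_le (by fun_prop) isClosed_univ (by simp)
    (integrable_haarAddCircle_of_continuous (by fun_prop))
    (integrable_haarAddCircle_of_continuous (by fun_prop))

end CircleL2

/-- The rotation of the plane by `angle` followed by the translation by `trans`. -/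
@[ext]
structure RigidMotion where
  angle : 𝕋
  trans : ℂ

namespace RigidMotion

noncomputable instance : One RigidMotion := ⟨⟨0, 0⟩⟩

noncomputable instance : Mul RigidMotion :=
  ⟨fun g h => ⟨g.angle + h.angle, g.trans + g.angle.toCircle * h.trans⟩⟩

@[simp]
lemma angle_one : (1 : RigidMotion).angle = 0 := rfl

@[simp]
lemma trans_one : (1 : RigidMotion).trans = 0 := rfl

@[simp]
lemma angle_mul (g h : RigidMotion) : (g * h).angle = g.angle + h.angle := rfl

@[simp]
lemma trans_mul (g h : RigidMotion) :
    (g * h).trans = g.trans + g.angle.toCircle * h.trans := rfl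

noncomputable instance : Monoid RigidMotion where
  mul_assoc g h k := by
    ext1
    · exact add_assoc _ _ _
    · simp only [trans_mul, angle_mul, AddCircle.toCircle_add, Circle.coe_mul]
      ring
  one_mul g := by ext1 <;> simp
  mul_one g := by ext1 <;> simp

lemma angle_pow (g : RigidMotion) (n : ℕ) : (g ^ n).angle = n • g.angle := by
  induction n with
  | zero => rw [pow_zero, angle_one, zero_nsmul]
  | succ n ih => rw [pow_succ, angle_mul, ih, succ_nsmul]

lemma inner_toCircle_sub (b : ℂ) (x y : 𝕋) :
    inner ℝ b ((x - y).toCircle : ℂ) = inner ℝ (y.toCircle * b) (x.toCircle : ℂ) := by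
  rw [sub_eq_add_neg, AddCircle.toCircle_add, AddCircle.toCircle_neg, Circle.coe_mul,
    Circle.coe_inv_eq_conj, Complex.inner, Complex.inner, map_mul]
  congr 1
  ring

/-- The action of rigid motions on functions on the circle of radius `R` of frequencies which is
dual to their action on the plane. -/
noncomputable def act (R : ℝ) : RigidMotion →* (CircleL2 →ₗᵢ[ℝ] CircleL2) where
  toFun g :=
    { toFun F := ⟨fun x => Circle.exp (R * inner ℝ g.trans (x.toCircle : ℂ)) * F (x - g.angle),
        by fun_prop⟩
      map_add' F G := by ext x; exact mul_add _ _ _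
      map_smul' c F := by ext x; exact mul_smul_comm c _ _
      norm_map' F := by
        rw [← sq_eq_sq₀ (norm_nonneg _) (norm_nonneg _), CircleL2.norm_sq_eq_integral,
          CircleL2.norm_sq_eq_integral,
          ← integral_sub_right_eq_self (fun x => ‖F x‖ ^ 2) g.angle]
        refine integral_congr_ae (.of_forall fun x => ?_)
        change ‖_ * F (x - g.angle)‖ ^ 2 = _
        rw [norm_mul, Circle.norm_coe, one_mul] }
  map_one' := by
    ext F x
    change _ * F (x - 0) = F x
    simp
  map_mul' g h := by
    ext F x
    change _ * F (x - (g.angle + h.angle)) = _ * (_ * F (x - g.angle - h.angle))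
    simp only [trans_mul, inner_add_left, inner_toCircle_sub, mul_add, Circle.exp_add,
      Circle.coe_mul, sub_sub, mul_assoc]

lemma act_apply (R : ℝ) (g : RigidMotion) (F : CircleL2) (x : 𝕋) :
    act R g F x = Circle.exp (R * inner ℝ g.trans (x.toCircle : ℂ)) * F (x - g.angle) := rfl

lemma norm_act_sub_act_apply (R : ℝ) {g h : RigidMotion} (hgh : g.angle = h.angle) (F : CircleL2)
    (x : 𝕋) : ‖(act R g F - act R h F) x‖
      = ‖(Circle.exp (R * inner ℝ (g.trans - h.trans) (x.toCircle : ℂ)) : ℂ) - 1‖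
        * ‖F (x - h.angle)‖ := by
  have hexp : (Circle.exp (R * inner ℝ g.trans (x.toCircle : ℂ)) : ℂ)
      = Circle.exp (R * inner ℝ h.trans (x.toCircle : ℂ))
        * Circle.exp (R * inner ℝ (g.trans - h.trans) (x.toCircle : ℂ)) := by
    rw [← Circle.coe_mul, ← Circle.exp_add, ← mul_add, ← inner_add_left, add_sub_cancel]
  rw [CircleL2.sub_apply, act_apply, act_apply, hgh, hexp, mul_assoc, ← mul_sub, norm_mul,
    Circle.norm_coe, one_mul, ← sub_one_mul, norm_mul]

end RigidMotion

/-! ### The distance to the origin on the circle -/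

lemma toCircle_coe (t : ℝ) : AddCircle.toCircle (t : 𝕋) = Circle.exp t := by
  rw [AddCircle.toCircle_apply_mk, div_self Real.two_pi_pos.ne', one_mul]

lemma exists_coe_eq_and_abs_eq_norm (x : 𝕋) : ∃ t : ℝ, (t : 𝕋) = x ∧ |t| = ‖x‖ := by
  obtain ⟨s, rfl⟩ := QuotientAddGroup.mk_surjective x
  refine ⟨s - round ((2 * Real.pi)⁻¹ * s) * (2 * Real.pi), ?_, (AddCircle.norm_eq _).symm⟩
  rw [AddCircle.coe_sub, ← zsmul_eq_mul, AddCircle.coe_zsmul, AddCircle.coe_period, smul_zero,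
    sub_zero]

lemma norm_circleExp_sub_one (t : ℝ) : ‖(Circle.exp t : ℂ) - 1‖ = 2 * |Real.sin (t / 2)| := by
  rw [Circle.coe_exp, mul_comm, Complex.norm_exp_I_mul_ofReal_sub_one, norm_mul,
    Real.norm_eq_abs, Real.norm_eq_abs, abs_two]

lemma norm_toCircle_sub_one_le (x : 𝕋) : ‖(x.toCircle : ℂ) - 1‖ ≤ ‖x‖ := by
  obtain ⟨t, rfl, ht⟩ := exists_coe_eq_and_abs_eq_norm x
  rw [toCircle_coe, norm_circleExp_sub_one, ← ht]
  have := Real.abs_sin_le_abs (x := t / 2)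
  rw [abs_div, abs_two] at this
  linarith

lemma two_div_pi_mul_norm_le_norm_toCircle_sub_one (x : 𝕋) :
    2 / Real.pi * ‖x‖ ≤ ‖(x.toCircle : ℂ) - 1‖ := by
  have hle := AddCircle.norm_le_half_period (2 * Real.pi) Real.two_pi_pos.ne' (x := x)
  obtain ⟨t, rfl, ht⟩ := exists_coe_eq_and_abs_eq_norm x
  rw [abs_of_pos Real.two_pi_pos, ← ht, mul_div_cancel_left₀ _ two_ne_zero] at hle
  have h := Real.mul_abs_le_abs_sin (x := t / 2) (by rw [abs_div, abs_two]; gcongr)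
  rw [abs_div, abs_two] at h
  rw [toCircle_coe, norm_circleExp_sub_one, ← ht]
  linarith

/-! ### Iterated differences -/

lemma norm_map_mul_sub_one_pow_sq_le {A E : Type*} [CommRing A] [SeminormedAddCommGroup E]
    (f : A →+ E) (w z : A) (k : ℕ) :
    ‖f (z * (w - 1) ^ k)‖ ^ 2 ≤ 4 ^ k * ∑ i ∈ Finset.range (k + 1), ‖f (z * w ^ i)‖ ^ 2 := by
  induction k generalizing z with
  | zero => simp
  | succ k ih =>
    have hshift : ∑ i ∈ Finset.range (k + 1), ‖f (z * w * w ^ i)‖ ^ 2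
        ≤ ∑ i ∈ Finset.range (k + 2), ‖f (z * w ^ i)‖ ^ 2 := by
      rw [Finset.sum_range_succ' _ (k + 1)]
      simp only [mul_assoc, ← pow_succ']
      exact le_add_of_nonneg_right (sq_nonneg _)
    have hinit : ∑ i ∈ Finset.range (k + 1), ‖f (z * w ^ i)‖ ^ 2
        ≤ ∑ i ∈ Finset.range (k + 2), ‖f (z * w ^ i)‖ ^ 2 := by
      rw [Finset.sum_range_succ _ (k + 1)]
      exact le_add_of_nonneg_right (sq_nonneg _)
    calc ‖f (z * (w - 1) ^ (k + 1))‖ ^ 2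
        = ‖f (z * w * (w - 1) ^ k) - f (z * (w - 1) ^ k)‖ ^ 2 := by
          rw [← map_sub]
          ring_nf
      _ ≤ (‖f (z * w * (w - 1) ^ k)‖ + ‖f (z * (w - 1) ^ k)‖) ^ 2 := by
          gcongr
          exact norm_sub_le _ _
      _ ≤ 2 * (‖f (z * w * (w - 1) ^ k)‖ ^ 2 + ‖f (z * (w - 1) ^ k)‖ ^ 2) := add_sq_le
      _ ≤ 2 * (4 ^ k * ∑ i ∈ Finset.range (k + 2), ‖f (z * w ^ i)‖ ^ 2
            + 4 ^ k * ∑ i ∈ Finset.range (k + 2), ‖f (z * w ^ i)‖ ^ 2) := by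
          gcongr
          · exact (ih _).trans (by gcongr)
          · exact (ih _).trans (by gcongr)
      _ = 4 ^ (k + 1) * ∑ i ∈ Finset.range (k + 1 + 1), ‖f (z * w ^ i)‖ ^ 2 := by ring

lemma im_sq_mul_norm_sq_le {w : ℂ} (hw : ‖w‖ = 1) (z : ℂ) :
    w.im ^ 2 * ‖z‖ ^ 2 ≤ 3 * (z.re ^ 2 + (z * w).re ^ 2) := by
  have hsq : w.re ^ 2 + w.im ^ 2 = 1 := by
    rw [← Complex.sq_norm_sub_sq_re w, hw]
    ring
  rw [← Complex.normSq_eq_norm_sq, Complex.normSq_apply, Complex.mul_re]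
  nlinarith [sq_nonneg (z.re * w.re + (z.re * w.re - z.im * w.im)), sq_nonneg (z.re * w.im),
    sq_nonneg (z.re * w.re - z.im * w.im), mul_nonneg (sq_nonneg z.re) (sq_nonneg w.re)]

lemma norm_coe_re_eq_abs {y : ℂ} (hy : ‖y‖ ≤ Real.pi) : ‖((y.re : ℝ) : 𝕋)‖ = |y.re| := by
  refine (AddCircle.norm_coe_eq_abs_iff _ Real.two_pi_pos.ne').2 ?_
  rw [abs_of_pos Real.two_pi_pos, mul_div_cancel_left₀ _ two_ne_zero]
  exact (Complex.abs_re_le_norm y).trans hy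

/-- The rotating sequence `Re (z wⁿ)` cannot be close to `2πℤ` along a long progression: its
iterated differences `Re (z wⁿ (w ^ q - 1) ^ k)` are too small to wrap around the circle, and two
consecutive ones determine `|z|`. -/
lemma im_sq_mul_le_sum_norm_coe_re {w : ℂ} (hw : ‖w‖ = 1) {z : ℂ} {k q : ℕ}
    (hz : ‖z‖ * ‖w ^ q - 1‖ ^ k ≤ Real.pi) :
    w.im ^ 2 * (‖z‖ * ‖w ^ q - 1‖ ^ k) ^ 2
      ≤ 3 * 4 ^ k * ∑ i ∈ Finset.range (k + 1),
        (‖(((z * w ^ (i * q)).re : ℝ) : 𝕋)‖ ^ 2 + ‖(((z * w ^ (i * q + 1)).re : ℝ) : 𝕋)‖ ^ 2) := by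
  set y : ℂ := z * (w ^ q - 1) ^ k with hy
  have hnorm : ‖y‖ = ‖z‖ * ‖w ^ q - 1‖ ^ k := by rw [hy, norm_mul, norm_pow]
  rw [← hnorm] at hz ⊢
  have hz' : ‖y * w‖ ≤ Real.pi := by rwa [norm_mul, hw, mul_one]
  let f : ℂ →+ 𝕋 :=
    (QuotientAddGroup.mk' (AddSubgroup.zmultiples (2 * Real.pi))).comp Complex.reAddGroupHom
  have hdiff := norm_map_mul_sub_one_pow_sq_le f (w ^ q) z k
  have hdiff' := norm_map_mul_sub_one_pow_sq_le f (w ^ q) (z * w) k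
  rw [mul_right_comm z w, ← hy] at hdiff'
  simp only [mul_assoc z, ← pow_mul, ← pow_succ', mul_comm q] at hdiff hdiff'
  calc w.im ^ 2 * ‖y‖ ^ 2 ≤ 3 * (y.re ^ 2 + (y * w).re ^ 2) := im_sq_mul_norm_sq_le hw y
    _ = 3 * (‖f y‖ ^ 2 + ‖f (y * w)‖ ^ 2) := by
      rw [← sq_abs y.re, ← sq_abs (y * w).re, ← norm_coe_re_eq_abs hz, ← norm_coe_re_eq_abs hz']
      rfl
    _ ≤ _ := by
      rw [mul_assoc (3 : ℝ), Finset.sum_add_distrib, mul_add (4 ^ k : ℝ)]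
      gcongr 3 * (?_ + ?_)
      · exact hdiff
      · exact hdiff'

/-! ### The spectral gap -/

lemma act_mem_range_pow {ι : Type*} {g : ι → RigidMotion} (R : ℝ) {n : ℕ} {W : RigidMotion}
    (hW : W ∈ Set.range g ^ n) :
    RigidMotion.act R W ∈ Set.range (fun i => RigidMotion.act R (g i)) ^ n := by
  have h := Set.mem_image_of_mem (RigidMotion.act R) hW
  rwa [Set.image_pow, ← Set.range_comp] at h

section Walk

variable {ι : Type*} [Fintype ι] {p : ι → ℝ} {g : ι → RigidMotion}

/-- The transfer operator, on the circle of frequencies of radius `R`, of the random walk which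
multiplies by `g i` with probability `p i`. -/
noncomputable def transferOp (p : ι → ℝ) (g : ι → RigidMotion) (R : ℝ) : Module.End ℝ CircleL2 :=
  avgOp p fun i => RigidMotion.act R (g i)

lemma norm_transferOp_apply_le (hp : p ∈ stdSimplex ℝ ι) (R : ℝ) (F : CircleL2) :
    ‖transferOp p g R F‖ ≤ ‖F‖ :=
  norm_avgOp_apply_le hp F

lemma transferOp_apply (R : ℝ) (F : CircleL2) (x : 𝕋) : transferOp p g R F x
    = ∑ i, (p i : ℂ) *
      (Circle.exp (R * inner ℝ (g i).trans (x.toCircle : ℂ)) * F (x - (g i).angle)) := by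
  simp only [transferOp, avgOp_apply, CircleL2.sum_apply, CircleL2.smul_apply,
    RigidMotion.act_apply, Complex.real_smul]

/-- The squared norm of `F` weighted by the squared distance of the phase `R ⟨τ, e^{i(x + y)}⟩`
to `2πℤ`. -/
noncomputable def phaseEnergy (R : ℝ) (τ : ℂ) (F : CircleL2) (y : 𝕋) : ℝ :=
  ∫ x : 𝕋, ‖((R * inner ℝ τ ((x + y).toCircle : ℂ) : ℝ) : 𝕋)‖ ^ 2 * ‖F x‖ ^ 2
    ∂AddCircle.haarAddCircle

lemma continuous_phaseEnergy_integrand (R : ℝ) (τ : ℂ) (F : CircleL2) (y : 𝕋) :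
    Continuous fun x : 𝕋 =>
      ‖((R * inner ℝ τ ((x + y).toCircle : ℂ) : ℝ) : 𝕋)‖ ^ 2 * ‖F x‖ ^ 2 :=
  (((AddCircle.continuous_mk' _).comp (by fun_prop)).norm.pow 2).mul (by fun_prop)

lemma phaseEnergy_le (R : ℝ) {W W' : RigidMotion} (hWW' : W.angle = W'.angle) (F : CircleL2) :
    phaseEnergy R (W.trans - W'.trans) F W'.angle
      ≤ Real.pi ^ 2 / 4 * ‖RigidMotion.act R W F - RigidMotion.act R W' F‖ ^ 2 := by
  rw [CircleL2.norm_sq_eq_integral, ← integral_add_right_eq_self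
    (fun x => ‖(RigidMotion.act R W F - RigidMotion.act R W' F) x‖ ^ 2) W'.angle,
    ← integral_const_mul]
  refine integral_mono
    (integrable_haarAddCircle_of_continuous (continuous_phaseEnergy_integrand _ _ _ _))
    (integrable_haarAddCircle_of_continuous (by fun_prop)) fun x => ?_
  have h := two_div_pi_mul_norm_le_norm_toCircle_sub_one
    ((R * inner ℝ (W.trans - W'.trans) ((x + W'.angle).toCircle : ℂ) : ℝ) : 𝕋)
  rw [toCircle_coe] at h
  simp only [RigidMotion.norm_act_sub_act_apply R hWW', add_sub_cancel_right, mul_pow, ← mul_assoc]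
  gcongr
  refine (pow_le_pow_left₀ (norm_nonneg _) ((le_div_iff₀' (by positivity)).2 h) 2).trans_eq ?_
  field_simp
  ring

variable {c : ℝ}

/-- Two words which differ only by the transposition of their first two letters have the same
rotation angle, and their translation parts differ by that of the commutator of these letters. -/
lemma phaseEnergy_commutator_le (hp : p ∈ stdSimplex ℝ ι) (hc : 0 < c) (hcp : ∀ i, c ≤ p i)
    (R : ℝ) (F : CircleL2) {n ℓ : ℕ} (hn : n + 2 ≤ ℓ) {W : RigidMotion}
    (hW : W ∈ Set.range g ^ n) (i j : ι) :
    phaseEnergy R ((g i * g j).trans - (g j * g i).trans) F ((g i).angle + (g j).angle + W.angle)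
      ≤ Real.pi ^ 2 * ℓ ^ 2 / c * (‖F‖ ^ 2 - ‖(transferOp p g R ^ ℓ) F‖ ^ 2) := by
  have hword : ∀ i j, g i * g j * W ∈ Set.range g ^ (n + 2) := fun i j => by
    rw [mul_assoc, pow_succ', pow_succ']
    exact Set.mul_mem_mul ⟨i, rfl⟩ (Set.mul_mem_mul ⟨j, rfl⟩ hW)
  have hangle : (g i * g j * W).angle = (g j * g i * W).angle := by
    simp only [RigidMotion.angle_mul, add_comm (g i).angle]
  have htrans : (g i * g j * W).trans - (g j * g i * W).trans
      = (g i * g j).trans - (g j * g i).trans := by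
    rw [RigidMotion.trans_mul _ W, RigidMotion.trans_mul _ W, RigidMotion.angle_mul (g j),
      add_comm (g j).angle, RigidMotion.angle_mul, add_sub_add_right_eq_sub]
  have hint := phaseEnergy_le R hangle F
  rw [htrans, RigidMotion.angle_mul, RigidMotion.angle_mul, add_comm (g j).angle] at hint
  have hdist := norm_word_sub_word_sq_le hp hc hcp hn (act_mem_range_pow R (hword i j))
    (act_mem_range_pow R (hword j i)) F
  calc _ ≤ _ := hint
    _ ≤ Real.pi ^ 2 / 4 * (4 * ℓ ^ 2 * (‖F‖ ^ 2 - ‖(transferOp p g R ^ ℓ) F‖ ^ 2) / c) := by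
      gcongr
      exact hdist
    _ = _ := by ring

lemma re_mul_conj_mul_toCircle_mul_pow (R : ℝ) (τ : ℂ) (x α : 𝕋) (n : ℕ) :
    (R * conj τ * x.toCircle * (α.toCircle : ℂ) ^ n).re
      = R * inner ℝ τ ((x + n • α).toCircle : ℂ) := by
  rw [AddCircle.toCircle_add, AddCircle.toCircle_nsmul, Circle.coe_mul, Circle.coe_pow,
    Complex.inner, ← Complex.re_ofReal_mul]
  ring_nf

lemma im_sq_mul_norm_sq_le_sum_phaseEnergy {R : ℝ} (hR : 0 ≤ R) {τ : ℂ} {α : 𝕋} {k q : ℕ}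
    (hRk : R * ‖τ‖ * ‖(α.toCircle : ℂ) ^ q - 1‖ ^ k ≤ Real.pi) (F : CircleL2) (y : 𝕋) :
    (α.toCircle : ℂ).im ^ 2 * (R * ‖τ‖ * ‖(α.toCircle : ℂ) ^ q - 1‖ ^ k) ^ 2 * ‖F‖ ^ 2
      ≤ 3 * 4 ^ k * ∑ l ∈ Finset.range (k + 1),
        (phaseEnergy R τ F (y + (l * q) • α) + phaseEnergy R τ F (y + (l * q + 1) • α)) := by
  set ω := (α.toCircle : ℂ)
  let z : 𝕋 → ℂ := fun x => R * conj τ * ((x + y).toCircle : ℂ)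
  let f : ℕ → 𝕋 → ℝ := fun n x => ‖(((z x * ω ^ n).re : ℝ) : 𝕋)‖ ^ 2 * ‖F x‖ ^ 2
  have hf : ∀ n, f n = fun x =>
      ‖((R * inner ℝ τ ((x + (y + n • α)).toCircle : ℂ) : ℝ) : 𝕋)‖ ^ 2 * ‖F x‖ ^ 2 :=
    fun n => funext fun x => by rw [← add_assoc, ← re_mul_conj_mul_toCircle_mul_pow]
  have hfint : ∀ n, Integrable (f n) AddCircle.haarAddCircle := fun n => by
    rw [hf]
    exact integrable_haarAddCircle_of_continuous (continuous_phaseEnergy_integrand _ _ _ _)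
  have hpt : ∀ x, ω.im ^ 2 * (R * ‖τ‖ * ‖ω ^ q - 1‖ ^ k) ^ 2 * ‖F x‖ ^ 2
      ≤ 3 * 4 ^ k * ∑ l ∈ Finset.range (k + 1), (f (l * q) x + f (l * q + 1) x) := fun x => by
    have hz : ‖z x‖ = R * ‖τ‖ := by simp [z, abs_of_nonneg hR, Circle.norm_coe]
    rw [← hz] at hRk ⊢
    simp only [f, ← add_mul, ← Finset.sum_mul, ← mul_assoc]
    exact mul_le_mul_of_nonneg_right
      (im_sq_mul_le_sum_norm_coe_re (Circle.norm_coe α.toCircle) hRk) (sq_nonneg _)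
  have hmono := integral_mono (integrable_haarAddCircle_of_continuous (by fun_prop))
    ((integrable_finsetSum _ fun l _ => (hfint _).add (hfint _)).const_mul _) hpt
  rw [integral_const_mul, integral_const_mul, ← CircleL2.norm_sq_eq_integral,
    integral_finsetSum _ fun l _ => (hfint _).add (hfint _),
    Finset.sum_congr rfl fun l _ => integral_add' (hfint _) (hfint _)] at hmono
  simpa only [hf, phaseEnergy] using hmono

/-- Among the words there are pairs whose translation parts differ by `τ` rotated by the multiples
of `α`. -/
theorem transferOp_spectral_gap (hp : p ∈ stdSimplex ℝ ι) (hc : 0 < c) (hcp : ∀ i, c ≤ p i) {α : 𝕋}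
    (hreach : ∀ K : ℕ, ∃ γ : 𝕋, ∀ k ≤ K, ∃ n ≤ K, ∃ W ∈ Set.range g ^ n, W.angle = γ + k • α)
    {i j : ι} {τ : ℂ} (hτ : (g i * g j).trans - (g j * g i).trans = τ) {R : ℝ} (hR : 0 ≤ R)
    {k q : ℕ} (hRk : R * ‖τ‖ * ‖(α.toCircle : ℂ) ^ q - 1‖ ^ k ≤ Real.pi) (F : CircleL2) :
    c * (α.toCircle : ℂ).im ^ 2 * ‖τ‖ ^ 2 * (R * ‖(α.toCircle : ℂ) ^ q - 1‖ ^ k) ^ 2 * ‖F‖ ^ 2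
      ≤ 6 * Real.pi ^ 2 * (4 ^ k * (k + 1) * (k * q + 3) ^ 2)
        * (‖F‖ ^ 2 - ‖(transferOp p g R ^ (k * q + 3)) F‖ ^ 2) := by
  obtain ⟨B, hB⟩ : ∃ B, B = Real.pi ^ 2 * (k * q + 3 : ℕ) ^ 2 / c
    * (‖F‖ ^ 2 - ‖(transferOp p g R ^ (k * q + 3)) F‖ ^ 2) := ⟨_, rfl⟩
  obtain ⟨γ, hγ⟩ := hreach (k * q + 1)
  set y := (g i).angle + (g j).angle + γ
  let I : ℕ → ℝ := fun n => phaseEnergy R τ F (y + n • α)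
  have hIB : ∀ n ≤ k * q + 1, I n ≤ B := fun n hn => by
    obtain ⟨N, hN, W, hW, hangle⟩ := hγ n hn
    have h := phaseEnergy_commutator_le hp hc hcp R F
      (show N + 2 ≤ k * q + 3 by omega) hW i j
    rwa [hτ, hangle, ← add_assoc _ γ, ← hB] at h
  have hsum : ∑ l ∈ Finset.range (k + 1), (I (l * q) + I (l * q + 1)) ≤ (k + 1) * (2 * B) := by
    have hterm : ∀ l ∈ Finset.range (k + 1), I (l * q) + I (l * q + 1) ≤ 2 * B := fun l hl => by
      have hlk : l * q ≤ k * q := Nat.mul_le_mul_right _ (Finset.mem_range_succ_iff.1 hl)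
      rw [two_mul]
      exact add_le_add (hIB _ (by omega)) (hIB _ (by omega))
    simpa using Finset.sum_le_card_nsmul _ _ _ hterm
  calc _ = c * ((α.toCircle : ℂ).im ^ 2
        * (R * ‖τ‖ * ‖(α.toCircle : ℂ) ^ q - 1‖ ^ k) ^ 2 * ‖F‖ ^ 2) := by ring
    _ ≤ c * (3 * 4 ^ k * ((k + 1) * (2 * B))) := by
      refine mul_le_mul_of_nonneg_left ?_ hc.le
      exact (im_sq_mul_norm_sq_le_sum_phaseEnergy hR hRk F y).trans (by gcongr)
    _ = _ := by
      rw [hB]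
      push_cast
      field_simp
      ring

end Walk

/-! ### Diophantine angles -/

lemma exists_norm_toCircle_pow_sub_one_le (x : 𝕋) {Q : ℕ} (hQ : 0 < Q) :
    ∃ q : ℕ, 0 < q ∧ q ≤ Q ∧ ‖(x.toCircle : ℂ) ^ q - 1‖ ≤ 2 * Real.pi / Q := by
  obtain ⟨q, hq, hqx⟩ := AddCircle.exists_norm_nsmul_le x hQ
  refine ⟨q, hq.1, hq.2, ?_⟩
  rw [← Circle.coe_pow, ← AddCircle.toCircle_nsmul]
  refine (norm_toCircle_sub_one_le _).trans (hqx.trans ?_)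
  have := Real.two_pi_pos
  gcongr
  exact_mod_cast Q.le_succ

lemma DiophantineAngle.exists_one_le_norm_nsmul {m α : ℝ} (h : DiophantineAngle m α) :
    ∃ q₀ M : ℕ, ∀ q : ℕ, 0 < q → q₀ ≤ q → 1 ≤ ‖q • (α : 𝕋)‖ * q ^ M := by
  obtain ⟨q₀, hq₀⟩ := h
  refine ⟨q₀, ⌈m⌉₊, fun q hq hqq => ?_⟩
  have hq' : (1 : ℝ) ≤ q := by exact_mod_cast hq
  obtain ⟨P, hP⟩ : ∃ P, P = round ((2 * Real.pi)⁻¹ * (q • α)) := ⟨_, rfl⟩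
  have hnorm : ‖q • (α : 𝕋)‖ = q * |α - 2 * Real.pi * P / q| := by
    rw [← AddCircle.coe_nsmul, AddCircle.norm_eq, ← hP, ← Nat.abs_cast, ← abs_mul, nsmul_eq_mul,
      Nat.abs_cast]
    congr 1
    field_simp
  calc (1 : ℝ) ≤ (q : ℝ) ^ (-m) * (q : ℝ) ^ ⌈m⌉₊ := by
        rw [← Real.rpow_natCast, ← Real.rpow_add (by positivity)]
        exact Real.one_le_rpow hq' (by linarith [Nat.le_ceil m])
    _ ≤ |α - 2 * Real.pi * P / q| * (q : ℝ) ^ ⌈m⌉₊ := by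
        gcongr
        exact hq₀ q hqq P
    _ ≤ _ := by
        rw [hnorm]
        gcongr
        exact le_mul_of_one_le_left (abs_nonneg _) hq'

lemma DiophantineAngle.exists_le_norm_toCircle_pow_sub_one {m α : ℝ} (h : DiophantineAngle m α) :
    ∃ c : ℝ, 0 < c ∧ ∃ M : ℕ, ∀ q : ℕ, 0 < q →
      c ≤ ‖(AddCircle.toCircle (α : 𝕋) : ℂ) ^ q - 1‖ * q ^ M := by
  obtain ⟨q₀, M, hM⟩ := h.exists_one_le_norm_nsmul
  set k := q₀ + 1
  refine ⟨2 / Real.pi / (k * k ^ M), by positivity, M, fun q hq => ?_⟩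
  have hk : ‖(k * q) • (α : 𝕋)‖ ≤ k * ‖q • (α : 𝕋)‖ := by
    rw [mul_smul]
    exact norm_nsmul_le
  have hlarge := hM (k * q) (by positivity) (q₀.le_succ.trans (Nat.le_mul_of_pos_right k hq))
  rw [← Circle.coe_pow, ← AddCircle.toCircle_nsmul, div_le_iff₀ (by positivity)]
  calc 2 / Real.pi ≤ 2 / Real.pi * (k * ‖q • (α : 𝕋)‖ * (k * q : ℕ) ^ M) :=
        le_mul_of_one_le_right (by positivity) (hlarge.trans (by gcongr))
    _ = 2 / Real.pi * ‖q • (α : 𝕋)‖ * q ^ M * (k * k ^ M) := by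
        push_cast
        ring
    _ ≤ _ := by
        gcongr
        exact two_div_pi_mul_norm_le_norm_toCircle_sub_one _

lemma im_ne_zero_of_sq_ne_one {w : ℂ} (hw : ‖w‖ = 1) (h : w ^ 2 ≠ 1) : w.im ≠ 0 := by
  intro h0
  have hre := Complex.sq_norm_sub_sq_im w
  rw [hw, h0] at hre
  apply h
  rw [← Complex.re_add_im w, h0, Complex.ofReal_zero, zero_mul, add_zero]
  exact_mod_cast (by linarith : w.re ^ 2 = 1)

/-! ### Decay of the iterates of the transfer operator -/

lemma natCast_div_sub_one_lt (m n : ℕ) : (m : ℝ) / n - 1 < (m / n : ℕ) := by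
  rw [← Nat.floor_div_eq_div (K := ℝ)]
  exact Nat.sub_one_lt_floor _

/-- The random walks, with steps `g i` of probability `p i`, whose transfer operators have a
spectral gap: the steps do not all commute, and the angles of the words contain arbitrarily long
arithmetic progressions whose difference `α` is Diophantine with exponent `M`. -/
structure IsDiophantineWalk {ι : Type*} [Fintype ι] (p : ι → ℝ) (g : ι → RigidMotion) (α : 𝕋)
    (M : ℕ) : Prop where
  mem_stdSimplex : p ∈ stdSimplex ℝ ι
  pos : ∀ i, 0 < p i
  exists_word : ∀ K : ℕ, ∃ γ : 𝕋, ∀ k ≤ K, ∃ n ≤ K, ∃ W ∈ Set.range g ^ n, W.angle = γ + k • α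
  exists_ne : ∃ i j, (g i * g j).trans ≠ (g j * g i).trans
  exists_le : ∃ c > 0, ∀ q : ℕ, 0 < q → c ≤ ‖(α.toCircle : ℂ) ^ q - 1‖ * q ^ M

namespace IsDiophantineWalk

variable {ι : Type*} [Fintype ι] {p : ι → ℝ} {g : ι → RigidMotion} {α : 𝕋} {M : ℕ}

lemma norm_pow_sub_one_pos (h : IsDiophantineWalk p g α M) {q : ℕ} (hq : 0 < q) :
    0 < ‖(α.toCircle : ℂ) ^ q - 1‖ := by
  obtain ⟨c, hc, hcq⟩ := h.exists_le
  exact pos_of_mul_pos_left (hc.trans_le (hcq q hq)) (by positivity)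

lemma im_ne_zero (h : IsDiophantineWalk p g α M) : (α.toCircle : ℂ).im ≠ 0 :=
  im_ne_zero_of_sq_ne_one (Circle.norm_coe _) <|
    sub_ne_zero.1 <| norm_pos_iff.1 <| h.norm_pow_sub_one_pos two_pos

lemma exists_spectral_gap (h : IsDiophantineWalk p g α M) :
    ∃ c > 0, ∃ ρ > 0, ∀ R : ℝ, 0 ≤ R → ∀ k q : ℕ, R * ‖(α.toCircle : ℂ) ^ q - 1‖ ^ k ≤ ρ → ∀ F,
      c * (R * ‖(α.toCircle : ℂ) ^ q - 1‖ ^ k) ^ 2 / (4 ^ k * (k + 1) * (k * q + 3) ^ 2) * ‖F‖ ^ 2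
        ≤ ‖F‖ ^ 2 - ‖(transferOp p g R ^ (k * q + 3)) F‖ ^ 2 := by
  obtain ⟨i, j, hij⟩ := h.exists_ne
  have hτ : 0 < ‖(g i * g j).trans - (g j * g i).trans‖ := norm_sub_pos_iff.2 hij
  obtain ⟨c, hc, hcp⟩ : ∃ c : ℝ, 0 < c ∧ ∀ i, c ≤ p i := by
    have : Nonempty ι := ⟨i⟩
    obtain ⟨i₀, hi₀⟩ := Finite.exists_min p
    exact ⟨p i₀, h.pos i₀, hi₀⟩
  have him := h.im_ne_zero
  refine ⟨c * (α.toCircle : ℂ).im ^ 2 * ‖(g i * g j).trans - (g j * g i).trans‖ ^ 2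
      / (6 * Real.pi ^ 2), by positivity, Real.pi / ‖(g i * g j).trans - (g j * g i).trans‖,
    by positivity, fun R hR k q hk F => ?_⟩
  rw [le_div_iff₀ hτ, mul_right_comm] at hk
  have hgap := transferOp_spectral_gap h.mem_stdSimplex hc hcp h.exists_word rfl hR hk F
  refine le_of_mul_le_mul_left ((le_of_eq ?_).trans hgap) (by positivity)
  field_simp

lemma exists_norm_transferOp_pow_le (h : IsDiophantineWalk p g α M) :
    ∃ ρ > 0, ∃ C > 0, ∃ c > 0, ∀ R : ℝ, 0 ≤ R → R ≤ ρ → ∀ (N : ℕ) F,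
      ‖(transferOp p g R ^ N) F‖ ≤ C * Real.exp (-c * N * R ^ 2) * ‖F‖ := by
  obtain ⟨c, hc, ρ, hρ, hgap⟩ := h.exists_spectral_gap
  refine ⟨ρ, hρ, Real.exp (c / 18 * ρ ^ 2), Real.exp_pos _, c / 9 / 6, by positivity,
    fun R hR hRρ N F => ?_⟩
  have hgap3 : ∀ F, c / 9 * R ^ 2 * ‖F‖ ^ 2 ≤ ‖F‖ ^ 2 - ‖(transferOp p g R ^ 3) F‖ ^ 2 := by
    intro F
    have hgap0 := hgap R hR 0 0 (by simpa using hRρ) F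
    norm_num at hgap0
    linarith
  refine le_of_sq_le_sq ?_ (by positivity)
  rw [mul_pow]
  refine (norm_pow_apply_sq_le_exp (norm_transferOp_apply_le h.mem_stdSimplex R) hgap3 N F).trans
    (mul_le_mul_of_nonneg_right ?_ (sq_nonneg _))
  rw [← Real.exp_add, ← Real.exp_nat_mul, Real.exp_le_exp]
  have hfloor : (N : ℝ) / 3 - 1 ≤ (N / 3 : ℕ) := mod_cast (natCast_div_sub_one_lt N 3).le
  have hmul := mul_le_mul_of_nonneg_left hfloor (by positivity : 0 ≤ c / 9 * R ^ 2)
  have hRρ2 : c / 9 * R ^ 2 ≤ c / 9 * ρ ^ 2 := by gcongr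
  push_cast
  linarith

end IsDiophantineWalk

lemma log_div_two_le_log_inv {y η : ℝ} (hy : 40 ≤ y) (hη0 : 0 < η) (hη : η ≤ 2 * Real.pi / y) :
    Real.log y / 2 ≤ Real.log η⁻¹ := by
  have hy0 : 0 < y := by linarith
  have hsqrt : 2 * Real.pi ≤ Real.sqrt y := by
    refine Real.le_sqrt_of_sq_le ?_
    nlinarith [Real.pi_lt_d2, Real.pi_pos]
  rw [← Real.log_sqrt hy0.le]
  refine Real.log_le_log (Real.sqrt_pos.2 hy0) ((?_ : _ ≤ y / (2 * Real.pi)).trans ?_)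
  · rw [le_div_iff₀ Real.two_pi_pos]
    calc Real.sqrt y * (2 * Real.pi) ≤ Real.sqrt y * Real.sqrt y := by gcongr
      _ = y := Real.mul_self_sqrt hy0.le
  · rw [← inv_div]
    exact inv_anti₀ hη0 hη

lemma four_pow_le_of_le_mul_pow {y R ρ η : ℝ} {n : ℕ} (hρ : 0 < ρ) (hy : 40 ≤ y) (hη0 : 0 < η)
    (hη : η ≤ 2 * Real.pi / y) (hR0 : 0 < R) (hR : R ≤ Real.exp (Real.log y ^ 2 / 8))
    (hlog : 8 * Real.log ρ⁻¹ ≤ Real.log y ^ 2) (hn : ρ ≤ R * η ^ n) : (4 : ℝ) ^ n ≤ y := by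
  have hly : 0 < Real.log y := Real.log_pos (by linarith)
  have hyη := log_div_two_le_log_inv hy hη0 hη
  have hlogR := (Real.log_le_iff_le_exp hR0).2 hR
  have hlogn := Real.log_le_log hρ hn
  rw [Real.log_mul hR0.ne' (by positivity), Real.log_pow] at hlogn
  rw [Real.log_inv] at hlog hyη
  have hmul : (n : ℝ) * (Real.log y / 2) ≤ n * -Real.log η := by gcongr
  have hn_le : (n : ℝ) ≤ Real.log y / 2 := by
    refine le_of_mul_le_mul_right ?_ (half_pos hly)
    linarith
  have hlog4 : Real.log 4 ≤ 2 := by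
    rw [show (4 : ℝ) = 2 ^ 2 by norm_num, Real.log_pow]
    push_cast
    linarith [Real.log_two_lt_d9]
  rw [← Real.log_le_log_iff (by positivity) (by linarith), Real.log_pow]
  calc n * Real.log 4 ≤ Real.log y / 2 * 2 := by gcongr
    _ = Real.log y := by ring

lemma div_twentytwo_le_natCast_div {y : ℝ} {n N ℓ : ℕ} (hy : 22 ≤ y) (hn : n ≠ 0) (hℓ0 : 0 < ℓ)
    (hℓ : (ℓ : ℝ) ≤ 11 * y ^ 2) (hN : (N : ℝ) = y ^ (n + 2)) : y ^ n / 22 ≤ (N / ℓ : ℕ) := by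
  have hℓ0' : (0 : ℝ) < ℓ := by exact_mod_cast hℓ0
  have hy_pow : 22 ≤ y ^ n := hy.trans (le_self_pow₀ (by linarith) hn)
  have hdiv : y ^ n / 11 ≤ N / ℓ := by
    rw [hN, div_le_div_iff₀ (by norm_num) hℓ0', pow_add]
    calc y ^ n * ℓ ≤ y ^ n * (11 * y ^ 2) := by gcongr
      _ = _ := by ring
  linarith [natCast_div_sub_one_lt N ℓ]

lemma pow_le_gap_mul_natCast_div {y a c η x ρ : ℝ} {M k q N : ℕ} (hy : 40 ≤ y) (ha : 0 < a)
    (hc : 0 < c) (hρ : 0 < ρ) (hq : (q : ℝ) ≤ 2 * y) (hη : a ≤ η * q ^ M) (hη0 : 0 < η)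
    (hk : (4 : ℝ) ^ k ≤ 4 * y) (hx : ρ * η ≤ x) (hN : (N : ℝ) = y ^ (8 * M + 32))
    (hyc : 1 ≤ c * ρ ^ 2 * a ^ 2 / (22 * 1936 * 4 ^ M) * y) :
    y ^ (4 * M + 16) ≤ c * x ^ 2 / (4 ^ k * (k + 1) * (k * q + 3) ^ 2)
      * (N / (k * q + 3) : ℕ) := by
  have hy1 : 1 ≤ y := by linarith
  have hk1 : (k : ℝ) + 1 ≤ 4 * y :=
    (by exact_mod_cast k.lt_pow_self (by norm_num : 1 < 4) : (k : ℝ) + 1 ≤ 4 ^ k).trans hk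
  have hℓ : (k : ℝ) * q + 3 ≤ 11 * y ^ 2 := by
    have : (k : ℝ) * q ≤ 4 * y * (2 * y) := by gcongr; linarith
    nlinarith
  have hden : (4 : ℝ) ^ k * (k + 1) * (k * q + 3) ^ 2 ≤ 1936 * y ^ 6 := by
    calc (4 : ℝ) ^ k * (k + 1) * (k * q + 3) ^ 2 ≤ 4 * y * (4 * y) * (11 * y ^ 2) ^ 2 := by gcongr
      _ = _ := by ring
  have hx2 : ρ ^ 2 * a ^ 2 / (4 ^ M * y ^ (2 * M)) ≤ x ^ 2 := by
    rw [div_le_iff₀ (by positivity)]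
    calc ρ ^ 2 * a ^ 2 ≤ ρ ^ 2 * (η * (2 * y) ^ M) ^ 2 := by
          gcongr
          exact hη.trans (by gcongr)
      _ = (ρ * η) ^ 2 * ((2 ^ M) ^ 2 * y ^ (2 * M)) := by ring
      _ ≤ x ^ 2 * (4 ^ M * y ^ (2 * M)) := by
          rw [← pow_mul, mul_comm M, pow_mul, show (2 : ℝ) ^ 2 = 4 by norm_num]
          gcongr
  have hfloor := div_twentytwo_le_natCast_div (n := 8 * M + 30) (ℓ := k * q + 3) (by linarith)
    (by omega) (by omega) (by exact_mod_cast hℓ) hN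
  calc y ^ (4 * M + 16) = 1 * y ^ (4 * M + 16) := (one_mul _).symm
    _ ≤ c * ρ ^ 2 * a ^ 2 / (22 * 1936 * 4 ^ M) * y * y ^ (6 * M + 23) := by
        refine mul_le_mul hyc (pow_le_pow_right₀ hy1 ?_) (by positivity) (by positivity)
        omega
    _ = c * (ρ ^ 2 * a ^ 2 / (4 ^ M * y ^ (2 * M))) / (1936 * y ^ 6) * (y ^ (8 * M + 30) / 22) := by
        field_simp
        ring
    _ ≤ _ := by gcongr

namespace IsDiophantineWalk

variable {ι : Type*} [Fintype ι] {p : ι → ℝ} {g : ι → RigidMotion} {α : 𝕋} {M : ℕ}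

/-- The scale `q ≤ ⌈y⌉` is provided by Dirichlet's theorem and `k` is then the number of
differences which bring the frequency `R` down to the range where the spectral gap applies. -/
lemma exists_scale (h : IsDiophantineWalk p g α M) {ρ y R : ℝ} (hρ : 0 < ρ) (hy : 40 ≤ y)
    (hlog : 8 * Real.log ρ⁻¹ ≤ Real.log y ^ 2) (hρR : ρ ≤ R)
    (hRy : R ≤ Real.exp (Real.log y ^ 2 / 8)) :
    ∃ k q : ℕ, 0 < q ∧ (q : ℝ) ≤ 2 * y ∧ (4 : ℝ) ^ k ≤ 4 * y ∧
      R * ‖(α.toCircle : ℂ) ^ q - 1‖ ^ k ≤ ρ ∧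
      ρ * ‖(α.toCircle : ℂ) ^ q - 1‖ ≤ R * ‖(α.toCircle : ℂ) ^ q - 1‖ ^ k := by
  have hy0 : 0 < y := by linarith
  have hR0 : 0 < R := hρ.trans_le hρR
  obtain ⟨q, hq0, hqy, hq⟩ := exists_norm_toCircle_pow_sub_one_le α (Nat.ceil_pos.2 hy0)
  have hη0 := h.norm_pow_sub_one_pos hq0
  set η := ‖(α.toCircle : ℂ) ^ q - 1‖
  have hηy : η ≤ 2 * Real.pi / y := by
    have := Real.two_pi_pos
    refine hq.trans ?_
    gcongr
    exact Nat.le_ceil y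
  have hη1 : η < 1 := by
    refine hηy.trans_lt ((div_lt_one hy0).2 ?_)
    linarith [Real.pi_lt_d2]
  obtain ⟨n, hn, hn'⟩ :=
    exists_nat_pow_near_of_lt_one (div_pos hρ hR0) ((div_le_one hR0).2 hρR) hη0 hη1
  rw [lt_div_iff₀' hR0] at hn
  rw [div_le_iff₀' hR0] at hn'
  have hqy' : (q : ℝ) ≤ ⌈y⌉₊ := by exact_mod_cast hqy
  refine ⟨n + 1, q, hq0, by linarith [Nat.ceil_lt_add_one hy0.le], ?_, hn.le, ?_⟩
  · rw [pow_succ']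
    gcongr
    exact four_pow_le_of_le_mul_pow hρ hy hη0 hηy hR0 hRy hlog hn'
  · rw [pow_succ, ← mul_assoc]
    gcongr

lemma exists_norm_transferOp_pow_sq_le (h : IsDiophantineWalk p g α M) {ρ : ℝ} (hρ : 0 < ρ) :
    ∃ y₀ : ℝ, ∀ y, y₀ ≤ y → ∀ N : ℕ, (N : ℝ) = y ^ (8 * M + 32) →
      ∀ R : ℝ, ρ ≤ R → R ≤ Real.exp (Real.log y ^ 2 / 8) → ∀ F,
      ‖(transferOp p g R ^ N) F‖ ^ 2 ≤ Real.exp (-y ^ (4 * M + 16)) * ‖F‖ ^ 2 := by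
  obtain ⟨a, ha, haq⟩ := h.exists_le
  obtain ⟨c, hc, ρ₁, hρ₁, hgap⟩ := h.exists_spectral_gap
  obtain ⟨r, hr0, hrρ, hrρ₁⟩ : ∃ r > 0, r ≤ ρ ∧ r ≤ ρ₁ :=
    ⟨min ρ ρ₁, lt_min hρ hρ₁, min_le_left _ _, min_le_right _ _⟩
  obtain ⟨y₀, hy₀⟩ := eventually_atTop.1 <| (eventually_ge_atTop (40 : ℝ)).and <|
    ((((tendsto_pow_atTop two_ne_zero).comp Real.tendsto_log_atTop).eventually_ge_atTop
      (8 * Real.log r⁻¹)).and <| (tendsto_id.const_mul_atTop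
        (by positivity : 0 < c * r ^ 2 * a ^ 2 / (22 * 1936 * 4 ^ M))).eventually_ge_atTop 1)
  refine ⟨y₀, fun y hy N hN R hρR hRy F => ?_⟩
  obtain ⟨hy40, hlog, hyc⟩ := hy₀ y hy
  obtain ⟨k, q, hq0, hq, hk, hkr, hrk⟩ := h.exists_scale hr0 hy40 hlog (hrρ.trans hρR) hRy
  have hrate := pow_le_gap_mul_natCast_div hy40 ha hc hr0 hq (haq q hq0)
    (h.norm_pow_sub_one_pos hq0) hk hrk hN hyc
  refine (norm_pow_apply_sq_le_exp (norm_transferOp_apply_le h.mem_stdSimplex R)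
    (hgap R (hρ.le.trans hρR) k q (hkr.trans hrρ₁)) N F).trans ?_
  gcongr
  linarith

end IsDiophantineWalk

/-! ### Low frequencies -/

lemma norm_circleExp_sub_taylor_le {y Y : ℝ} (hy : |y| ≤ Y) :
    ‖(Circle.exp y : ℂ) - (1 + y * Complex.I - y ^ 2 / 2)‖ ≤ |y| ^ 3 * Real.exp Y := by
  have h := Complex.norm_exp_sub_sum_le_norm_mul_exp (y * Complex.I) 3
  have htaylor : ∑ m ∈ Finset.range 3, (y * Complex.I : ℂ) ^ m / m.factorial
      = 1 + y * Complex.I - y ^ 2 / 2 := by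
    simp only [Finset.sum_range_succ, Finset.sum_range_zero, mul_pow, Nat.factorial]
    push_cast
    rw [Complex.I_sq]
    ring
  rw [htaylor, norm_mul, Complex.norm_I, mul_one, Complex.norm_real, Real.norm_eq_abs,
    ← Circle.coe_exp] at h
  exact h.trans (by gcongr)

lemma abs_exp_neg_sub_one_sub_le_sq {s : ℝ} (hs : 0 ≤ s) : |Real.exp (-s) - (1 - s)| ≤ s ^ 2 := by
  rw [abs_of_nonneg (by linarith [Real.add_one_le_exp (-s)]), sub_le_iff_le_add']
  refine le_of_mul_le_mul_right ?_ (by linarith : 0 < 1 + s)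
  calc Real.exp (-s) * (1 + s) ≤ Real.exp (-s) * Real.exp s := by
        gcongr
        linarith [Real.add_one_le_exp s]
    _ = 1 := by rw [← Real.exp_add, neg_add_cancel, Real.exp_zero]
    _ ≤ (1 - s + s ^ 2) * (1 + s) := by linarith [pow_nonneg hs 3]

/-- The real part of `A e^{2ix}`, as a function of `x`. -/
noncomputable def secondHarmonic : ℂ →ₗ[ℝ] CircleL2 where
  toFun A := ⟨fun x => ((A * (x.toCircle : ℂ) ^ 2).re : ℂ), by fun_prop⟩
  map_add' A B := by
    ext x
    exact (congrArg (fun z : ℂ => (z.re : ℂ)) (add_mul A B _)).trans (Complex.ofReal_add _ _)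
  map_smul' c A := by
    ext x
    change (((c • A) * (x.toCircle : ℂ) ^ 2).re : ℂ) = c • ((A * (x.toCircle : ℂ) ^ 2).re : ℂ)
    rw [smul_mul_assoc, Complex.smul_re, Complex.real_smul, smul_eq_mul, Complex.ofReal_mul]

lemma secondHarmonic_apply (A : ℂ) (x : 𝕋) :
    secondHarmonic A x = ((A * (x.toCircle : ℂ) ^ 2).re : ℂ) := rfl

lemma norm_secondHarmonic_apply_le (A : ℂ) (x : 𝕋) : ‖secondHarmonic A x‖ ≤ ‖A‖ := by
  rw [secondHarmonic_apply, Complex.norm_real]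
  refine (Complex.abs_re_le_norm _).trans_eq ?_
  rw [norm_mul, norm_pow, Circle.norm_coe, one_pow, mul_one]

lemma inner_toCircle_sq (b : ℂ) (x : 𝕋) :
    inner ℝ b (x.toCircle : ℂ) ^ 2
      = ‖b‖ ^ 2 / 2 + (conj (b ^ 2) * (x.toCircle : ℂ) ^ 2).re / 2 := by
  have h := Circle.normSq_coe x.toCircle
  set u := (x.toCircle : ℂ)
  rw [Complex.normSq_apply] at h
  rw [Complex.inner, ← Complex.normSq_eq_norm_sq, Complex.normSq_apply, pow_two b, pow_two u]
  simp only [map_mul, Complex.mul_re, Complex.mul_im, Complex.conj_re, Complex.conj_im]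
  linear_combination ((b.re * b.re + b.im * b.im) / 2) * h

section Walk

variable {ι : Type*} [Fintype ι] {p : ι → ℝ} {g : ι → RigidMotion}

/-- The variance in each direction of a step of the walk, averaged over the directions. -/
noncomputable def stepVariance (p : ι → ℝ) (g : ι → RigidMotion) : ℝ :=
  (∑ i, p i * ‖(g i).trans‖ ^ 2) / 2

lemma stepVariance_nonneg (hp : p ∈ stdSimplex ℝ ι) : 0 ≤ stepVariance p g :=
  div_nonneg (Finset.sum_nonneg fun i _ => mul_nonneg (hp.1 i) (sq_nonneg _)) zero_le_two

lemma sum_smul_secondHarmonic_sub (A : ℂ) (x : 𝕋) :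
    ∑ i, p i • secondHarmonic A (x - (g i).angle)
      = secondHarmonic (A * conj (∑ i, p i • ((g i).angle.toCircle : ℂ) ^ 2)) x := by
  have h : ∀ i, p i • secondHarmonic A (x - (g i).angle)
      = ((A * (x.toCircle : ℂ) ^ 2 * conj (p i • ((g i).angle.toCircle : ℂ) ^ 2)).re : ℂ) := by
    intro i
    rw [secondHarmonic_apply, sub_eq_add_neg, AddCircle.toCircle_add, AddCircle.toCircle_neg,
      Circle.coe_mul, Circle.coe_inv_eq_conj, Complex.real_smul, Complex.real_smul,
      ← Complex.ofReal_mul, ← Complex.re_ofReal_mul, map_mul, map_pow, Complex.conj_ofReal]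
    ring_nf
  rw [Finset.sum_congr rfl fun i _ => h i, secondHarmonic_apply, ← Complex.ofReal_sum,
    ← Complex.re_sum, ← Finset.mul_sum, ← map_sum, mul_right_comm]

lemma sum_smul_taylor_eq (hp : p ∈ stdSimplex ℝ ι) (hmean : ∑ i, p i • (g i).trans = 0) (R : ℝ)
    (x : 𝕋) :
    ∑ i, p i • (1 + (R * inner ℝ (g i).trans (x.toCircle : ℂ) : ℝ) * Complex.I
        - ((R * inner ℝ (g i).trans (x.toCircle : ℂ) : ℝ) : ℂ) ^ 2 / 2)
      = 1 - ((stepVariance p g * R ^ 2 / 2 : ℝ) : ℂ)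
        - (R ^ 2 / 4) • secondHarmonic (conj (∑ i, p i • (g i).trans ^ 2)) x := by
  have hinner : ∑ i, p i * inner ℝ (g i).trans (x.toCircle : ℂ) = 0 := by
    rw [← inner_zero_left (𝕜 := ℝ) (x.toCircle : ℂ), ← hmean, sum_inner]
    simp only [real_inner_smul_left]
  have h : ∀ i, p i • (1 + (R * inner ℝ (g i).trans (x.toCircle : ℂ) : ℝ) * Complex.I
        - ((R * inner ℝ (g i).trans (x.toCircle : ℂ) : ℝ) : ℂ) ^ 2 / 2)
      = (p i : ℂ) + ((R * (p i * inner ℝ (g i).trans (x.toCircle : ℂ)) : ℝ) : ℂ) * Complex.I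
        - ((R ^ 2 / 4 * (p i * ‖(g i).trans‖ ^ 2) : ℝ) : ℂ)
        - ((R ^ 2 / 4 * (conj (p i • (g i).trans ^ 2) * (x.toCircle : ℂ) ^ 2).re : ℝ) : ℂ) := by
    intro i
    rw [← Complex.ofReal_pow, mul_pow, inner_toCircle_sq, Complex.real_smul, Complex.real_smul,
      map_mul, Complex.conj_ofReal, mul_assoc (p i : ℂ) (conj _), Complex.re_ofReal_mul]
    push_cast
    ring
  rw [Finset.sum_congr rfl fun i _ => h i, Finset.sum_sub_distrib, Finset.sum_sub_distrib,
    Finset.sum_add_distrib, ← Finset.sum_mul, ← Complex.ofReal_sum, hp.2, ← Complex.ofReal_sum,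
    ← Finset.mul_sum, hinner, ← Complex.ofReal_sum, ← Finset.mul_sum, ← Complex.ofReal_sum,
    ← Finset.mul_sum, ← Complex.re_sum, ← Finset.sum_mul, ← map_sum, secondHarmonic_apply,
    stepVariance, Complex.real_smul]
  push_cast
  ring

variable {Y R : ℝ}

lemma abs_mul_inner_toCircle_le {b : ℂ} (hb : ‖b‖ ≤ Y) (hR : 0 ≤ R) (x : 𝕋) :
    |R * inner ℝ b (x.toCircle : ℂ)| ≤ Y * R := by
  rw [abs_mul, abs_of_nonneg hR, mul_comm]
  gcongr
  refine (abs_real_inner_le_norm _ _).trans ?_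
  rwa [Circle.norm_coe, mul_one]

lemma norm_transferOp_one_sub_le (hp : p ∈ stdSimplex ℝ ι) (hmean : ∑ i, p i • (g i).trans = 0)
    (hY : ∀ i, ‖(g i).trans‖ ≤ Y) (hR : 0 ≤ R) :
    ‖transferOp p g R 1 - ((1 - stepVariance p g * R ^ 2 / 2) • (1 : CircleL2)
        - (R ^ 2 / 4) • secondHarmonic (conj (∑ i, p i • (g i).trans ^ 2)))‖
      ≤ Y ^ 3 * Real.exp (Y * R) * R ^ 3 := by
  refine CircleL2.norm_le_of_forall_norm_le fun x => ?_
  have heq : (transferOp p g R 1 - ((1 - stepVariance p g * R ^ 2 / 2) • (1 : CircleL2)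
        - (R ^ 2 / 4) • secondHarmonic (conj (∑ i, p i • (g i).trans ^ 2)))) x
      = ∑ i, p i • ((Circle.exp (R * inner ℝ (g i).trans (x.toCircle : ℂ)) : ℂ)
        - (1 + (R * inner ℝ (g i).trans (x.toCircle : ℂ) : ℝ) * Complex.I
          - ((R * inner ℝ (g i).trans (x.toCircle : ℂ) : ℝ) : ℂ) ^ 2 / 2)) := by
    rw [Finset.sum_congr rfl fun i _ => smul_sub (p i) _ _, Finset.sum_sub_distrib,
      sum_smul_taylor_eq hp hmean]
    simp only [CircleL2.sub_apply, CircleL2.smul_apply, CircleL2.one_apply, transferOp_apply,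
      mul_one, Complex.real_smul]
    push_cast
    ring
  rw [heq]
  refine norm_sum_smul_le_of_mem_stdSimplex hp fun i => ?_
  have hy := abs_mul_inner_toCircle_le (hY i) hR x
  refine (norm_circleExp_sub_taylor_le hy).trans ?_
  calc _ ≤ (Y * R) ^ 3 * Real.exp (Y * R) := by gcongr
    _ = _ := by ring

lemma norm_transferOp_secondHarmonic_sub_le (hp : p ∈ stdSimplex ℝ ι)
    (hY : ∀ i, ‖(g i).trans‖ ≤ Y) (hR : 0 ≤ R) (A : ℂ) :
    ‖transferOp p g R (secondHarmonic A)
        - secondHarmonic (A * conj (∑ i, p i • ((g i).angle.toCircle : ℂ) ^ 2))‖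
      ≤ Y * R * ‖A‖ := by
  refine CircleL2.norm_le_of_forall_norm_le fun x => ?_
  rw [CircleL2.sub_apply, transferOp_apply, ← sum_smul_secondHarmonic_sub,
    ← Finset.sum_sub_distrib]
  simp only [← Complex.real_smul, ← smul_sub, ← sub_one_mul]
  refine norm_sum_smul_le_of_mem_stdSimplex hp fun i => ?_
  have hy := abs_mul_inner_toCircle_le (hY i) hR x
  rw [norm_mul, Circle.coe_exp, mul_comm _ Complex.I]
  exact mul_le_mul (Real.norm_exp_I_mul_ofReal_sub_one_le.trans hy)
    (norm_secondHarmonic_apply_le _ _) (norm_nonneg _) ((abs_nonneg _).trans hy)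

/-- The second order term of the expansion of `transferOp p g R 1` is not constant unless the second
moment `∑ i, p i • (g i).trans ^ 2` vanishes; the correction `R ^ 2 • secondHarmonic A` removes the
nonconstant part. -/
lemma norm_transferOp_sub_exp_smul_le (hp : p ∈ stdSimplex ℝ ι)
    (hmean : ∑ i, p i • (g i).trans = 0) (hY : ∀ i, ‖(g i).trans‖ ≤ Y) (hR : 0 ≤ R) {A : ℂ}
    (hA : A * conj (∑ i, p i • ((g i).angle.toCircle : ℂ) ^ 2)
      = A + (1 / 4 : ℝ) • conj (∑ i, p i • (g i).trans ^ 2)) :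
    ‖transferOp p g R (1 + R ^ 2 • secondHarmonic A)
        - Real.exp (-(stepVariance p g * R ^ 2 / 2)) • (1 + R ^ 2 • secondHarmonic A)‖
      ≤ (Y ^ 3 * Real.exp (Y * R) + Y * ‖A‖ + stepVariance p g ^ 2 * R / 4
        + stepVariance p g * R * ‖A‖ / 2) * R ^ 3 := by
  have hconst := norm_transferOp_one_sub_le hp hmean hY hR
  have hharm := norm_transferOp_secondHarmonic_sub_le hp hY hR A
  rw [hA, map_add, map_smul] at hharm
  set T := transferOp p g R
  set m := ∑ i, p i • (g i).trans ^ 2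
  set s := stepVariance p g * R ^ 2 / 2 with hs
  set e := Real.exp (-s)
  have hs0 : 0 ≤ s := by have := stepVariance_nonneg (g := g) hp; positivity
  have he : e ≤ 1 := Real.exp_le_one_iff.2 (by linarith)
  have hdecomp : T (1 + R ^ 2 • secondHarmonic A) - e • (1 + R ^ 2 • secondHarmonic A)
      = (T 1 - ((1 - s) • (1 : CircleL2) - (R ^ 2 / 4) • secondHarmonic (conj m)))
        + R ^ 2 • (T (secondHarmonic A)
          - (secondHarmonic A + (1 / 4 : ℝ) • secondHarmonic (conj m)))
        + (-(e - (1 - s))) • (1 : CircleL2) + (R ^ 2 * (1 - e)) • secondHarmonic A := by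
    rw [map_add, map_smul]
    module
  rw [hdecomp]
  refine norm_add₄_le.trans ?_
  rw [norm_smul, norm_smul, norm_smul, norm_neg, Real.norm_of_nonneg (sq_nonneg R),
    Real.norm_of_nonneg (mul_nonneg (sq_nonneg R) (sub_nonneg.2 he)), Real.norm_eq_abs]
  calc _ ≤ Y ^ 3 * Real.exp (Y * R) * R ^ 3 + R ^ 2 * (Y * R * ‖A‖) + s ^ 2 * 1
        + R ^ 2 * s * ‖A‖ := by
        gcongr
        · exact abs_exp_neg_sub_one_sub_le_sq hs0
        · exact CircleL2.norm_le_of_forall_norm_le (by simp)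
        · linarith [Real.add_one_le_exp (-s)]
        · exact CircleL2.norm_le_of_forall_norm_le (norm_secondHarmonic_apply_le A)
    _ = _ := by rw [hs]; ring

/-- The correction exists because the transfer operator at frequency zero does not fix the second
harmonics. -/
lemma exists_approx_eigenvector (hp : p ∈ stdSimplex ℝ ι) (hmean : ∑ i, p i • (g i).trans = 0)
    (hangle : ∑ i, p i • ((g i).angle.toCircle : ℂ) ^ 2 ≠ 1) {ρ : ℝ} (hρ : 0 < ρ) :
    ∃ A : ℂ, ∃ C > 0, ∀ R : ℝ, 0 ≤ R → R ≤ ρ →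
      ‖transferOp p g R (1 + R ^ 2 • secondHarmonic A)
        - Real.exp (-(stepVariance p g * R ^ 2 / 2)) • (1 + R ^ 2 • secondHarmonic A)‖
        ≤ C * R ^ 3 := by
  have hv : 0 ≤ stepVariance p g := stepVariance_nonneg hp
  obtain ⟨Y, hY0, hY⟩ : ∃ Y > 0, ∀ i, ‖(g i).trans‖ ≤ Y := by
    obtain ⟨Y, hY⟩ := (Set.finite_range fun i => ‖(g i).trans‖).bddAbove
    exact ⟨max Y 1, by positivity, fun i => (hY ⟨i, rfl⟩).trans (le_max_left _ _)⟩
  obtain ⟨A, hA⟩ : ∃ A : ℂ, A * conj (∑ i, p i • ((g i).angle.toCircle : ℂ) ^ 2)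
      = A + (1 / 4 : ℝ) • conj (∑ i, p i • (g i).trans ^ 2) := by
    set L := ∑ i, p i • ((g i).angle.toCircle : ℂ) ^ 2
    set m := ∑ i, p i • (g i).trans ^ 2
    have hL : conj L - 1 ≠ 0 := fun h =>
      hangle (by simpa using congrArg conj (sub_eq_zero.1 h))
    refine ⟨conj m / (4 * (conj L - 1)), ?_⟩
    rw [Complex.real_smul]
    push_cast
    field_simp
    ring
  refine ⟨A, Y ^ 3 * Real.exp (Y * ρ) + Y * ‖A‖ + stepVariance p g ^ 2 * ρ / 4
    + stepVariance p g * ρ * ‖A‖ / 2, by positivity, fun R hR hRρ => ?_⟩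
  refine (norm_transferOp_sub_exp_smul_le hp hmean hY hR hA).trans ?_
  gcongr

lemma pow_sub_one_le_div {a m : ℝ} (hm : 0 < m) (hma : m ≤ a) (ha : a ≤ 1) (N : ℕ) :
    a ^ (N - 1) ≤ a ^ N / m := by
  rw [le_div_iff₀ hm]
  cases N with
  | zero => simpa using hma.trans ha
  | succ N => rw [Nat.add_sub_cancel, pow_succ]; gcongr; exact pow_nonneg (hm.le.trans hma) N

lemma exists_norm_transferOp_pow_one_sub_le (hp : p ∈ stdSimplex ℝ ι)
    (hmean : ∑ i, p i • (g i).trans = 0) (hv : 0 < stepVariance p g)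
    (hangle : ∑ i, p i • ((g i).angle.toCircle : ℂ) ^ 2 ≠ 1) {ρ : ℝ} (hρ : 0 < ρ)
    (hdecay : ∃ C > 0, ∃ c > 0, ∀ R : ℝ, 0 ≤ R → R ≤ ρ → ∀ (N : ℕ) F,
      ‖(transferOp p g R ^ N) F‖ ≤ C * Real.exp (-c * N * R ^ 2) * ‖F‖) :
    ∃ C > 0, ∃ c > 0, ∀ R : ℝ, 0 ≤ R → R ≤ ρ → ∀ N : ℕ,
      ‖(transferOp p g R ^ N) 1 - Real.exp (-(stepVariance p g * N * R ^ 2 / 2)) • 1‖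
        ≤ C * (N * R ^ 3 + R ^ 2) * Real.exp (-c * N * R ^ 2) := by
  obtain ⟨C₁, hC₁, c₁, hc₁, hdecay⟩ := hdecay
  obtain ⟨A, C₂, hC₂, happrox⟩ := exists_approx_eigenvector hp hmean hangle hρ
  set v := stepVariance p g
  set c := min c₁ (v / 2)
  have hc0 : 0 < c := lt_min hc₁ (half_pos hv)
  refine ⟨C₁ / Real.exp (-(c * ρ ^ 2)) * C₂ + C₁ * ‖A‖ + ‖A‖, by positivity, c, hc0,
    fun R hR hRρ N => ?_⟩
  set T := transferOp p g R
  set a := Real.exp (-(c * R ^ 2)) with ha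
  set s := Real.exp (-(v * R ^ 2 / 2)) with hs
  have haN : ∀ N : ℕ, Real.exp (-c * N * R ^ 2) = a ^ N := fun N => by
    rw [ha, ← Real.exp_nat_mul]; ring_nf
  have hsN : Real.exp (-(v * N * R ^ 2 / 2)) = s ^ N := by
    rw [hs, ← Real.exp_nat_mul]; ring_nf
  have hsa : s ≤ a := by
    have : c * R ^ 2 ≤ v / 2 * R ^ 2 := by gcongr; exact min_le_right _ _
    exact Real.exp_le_exp.2 (by linarith)
  have hdecay' : ∀ N F, ‖(T ^ N) F‖ ≤ C₁ * a ^ N * ‖F‖ := fun N F => by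
    refine (hdecay R hR hRρ N F).trans ?_
    rw [← haN]
    gcongr
    exact min_le_left _ _
  have hHA : ‖R ^ 2 • secondHarmonic A‖ ≤ R ^ 2 * ‖A‖ := by
    rw [norm_smul, Real.norm_of_nonneg (sq_nonneg R)]
    gcongr
    exact CircleL2.norm_le_of_forall_norm_le (norm_secondHarmonic_apply_le A)
  have haN1 : a ^ (N - 1) ≤ a ^ N / Real.exp (-(c * ρ ^ 2)) :=
    pow_sub_one_le_div (Real.exp_pos _) (Real.exp_le_exp.2 (by gcongr))
      (Real.exp_le_one_iff.2 (by rw [neg_nonpos]; positivity)) N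
  rw [haN, hsN]
  calc _ ≤ _ := norm_pow_apply_sub_pow_smul_le_of_add hC₁.le (Real.exp_pos _).le hsa hdecay'
        (happrox R hR hRρ) N
    _ ≤ N * (C₁ * (a ^ N / Real.exp (-(c * ρ ^ 2))) * (C₂ * R ^ 3))
        + (C₁ + 1) * a ^ N * (R ^ 2 * ‖A‖) := by gcongr
    _ ≤ _ := by
        have h₁ : 0 ≤ C₁ / Real.exp (-(c * ρ ^ 2)) * C₂ * R ^ 2 * a ^ N := by positivity
        have h₂ : 0 ≤ (C₁ + 1) * ‖A‖ * (N * R ^ 3) * a ^ N := by positivity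
        linear_combination h₁ + h₂

end Walk

/-! ### A bound for all frequencies -/

lemma exists_one_add_pow_mul_exp_le {c : ℝ} (hc : 0 < c) (n : ℕ) :
    ∃ C > 0, ∀ t : ℝ, 0 ≤ t → (1 + t) ^ n * Real.exp (-c * t) ≤ C := by
  refine ⟨n.factorial / c ^ n * Real.exp c, by positivity, fun t ht => ?_⟩
  have hpow := Real.pow_div_factorial_le_exp (c * (1 + t)) (by positivity) n
  rw [div_le_iff₀ (by positivity), mul_pow] at hpow
  have hle : (1 + t) ^ n ≤ n.factorial / c ^ n * Real.exp (c + c * t) := by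
    rw [div_mul_eq_mul_div, le_div_iff₀ (by positivity), show c + c * t = c * (1 + t) by ring]
    linarith
  calc (1 + t) ^ n * Real.exp (-c * t)
      ≤ n.factorial / c ^ n * Real.exp (c + c * t) * Real.exp (-c * t) := by gcongr
    _ = n.factorial / c ^ n * Real.exp c := by
      rw [mul_assoc, ← Real.exp_add]
      ring_nf

lemma exists_mul_add_mul_exp_le {C c ρ : ℝ} (hC : 0 < C) (hc : 0 < c) (hρ : 0 < ρ) :
    ∃ C' > 0, ∀ (R : ℝ) (N : ℕ), 0 < R → R ≤ ρ → 0 < N →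
      R * (C * (N * R ^ 3 + R ^ 2) * Real.exp (-c * N * R ^ 2)) ≤ C' / (N * (1 + N * R ^ 2)) := by
  obtain ⟨K, hK, hKb⟩ := exists_one_add_pow_mul_exp_le hc 3
  refine ⟨C * (1 + ρ) * K, by positivity, fun R N hR hRρ hN => ?_⟩
  rw [le_div_iff₀ (by positivity), mul_assoc (-c)]
  obtain ⟨t, ht⟩ : ∃ t : ℝ, t = N * R ^ 2 := ⟨_, rfl⟩
  have ht0 : 0 ≤ t := ht ▸ by positivity
  have hquad : t ^ 2 + R * t ≤ (1 + ρ) * (1 + t) ^ 2 := by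
    nlinarith [mul_le_mul_of_nonneg_right hRρ ht0, mul_nonneg hρ.le ht0,
      mul_nonneg hρ.le (sq_nonneg t)]
  calc R * (C * (N * R ^ 3 + R ^ 2) * Real.exp (-c * (N * R ^ 2))) * (N * (1 + N * R ^ 2))
      = C * (t ^ 2 + R * t) * (1 + t) * Real.exp (-c * t) := by rw [ht]; ring
    _ ≤ C * ((1 + ρ) * (1 + t) ^ 2) * (1 + t) * Real.exp (-c * t) := by gcongr
    _ = C * (1 + ρ) * ((1 + t) ^ 3 * Real.exp (-c * t)) := by ring
    _ ≤ _ := by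
      gcongr
      exact hKb t ht0

lemma exists_mul_exp_le {v ρ : ℝ} (hv : 0 < v) (hρ : 0 < ρ) :
    ∃ C > 0, ∀ (R : ℝ) (N : ℕ), ρ ≤ R → 0 < N →
      R * Real.exp (-(v * N * R ^ 2 / 2)) ≤ C / (N * (1 + N * R ^ 2)) := by
  obtain ⟨K, hK, hKb⟩ := exists_one_add_pow_mul_exp_le (half_pos hv) 2
  refine ⟨K / ρ, by positivity, fun R N hR hN => ?_⟩
  have hR0 : 0 < R := hρ.trans_le hR
  rw [le_div_iff₀ (by positivity), le_div_iff₀ hρ,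
    show -(v * N * R ^ 2 / 2) = -(v / 2) * (N * R ^ 2) by ring]
  obtain ⟨t, ht⟩ : ∃ t : ℝ, t = N * R ^ 2 := ⟨_, rfl⟩
  have ht0 : 0 ≤ t := ht ▸ by positivity
  calc R * Real.exp (-(v / 2) * (N * R ^ 2)) * (N * (1 + N * R ^ 2)) * ρ
      ≤ R * Real.exp (-(v / 2) * (N * R ^ 2)) * (N * (1 + N * R ^ 2)) * R := by gcongr
    _ = t * (1 + t) * Real.exp (-(v / 2) * t) := by rw [ht]; ring
    _ ≤ (1 + t) ^ 2 * Real.exp (-(v / 2) * t) := by gcongr; nlinarith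
    _ ≤ K := hKb t ht0

lemma mul_exp_neg_pow_le {y N R : ℝ} {n : ℕ} (hn : 3 ≤ n) (hy : Real.exp (64 * n) ≤ y)
    (hN : N = y ^ (2 * n)) (hR : 0 < R) (hRy : R ≤ Real.exp (Real.log y ^ 2 / 8)) :
    R * Real.exp (-y ^ n / 2) ≤ 2 / (N * (1 + N * R ^ 2)) := by
  have hny : 64 * n + 1 ≤ y := (Real.add_one_le_exp _).trans hy
  have hn3 : (3 : ℝ) ≤ n := by exact_mod_cast hn
  have hy0 : 0 < y := by linarith
  have hN1 : 1 ≤ N := hN ▸ one_le_pow₀ (by linarith)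
  obtain ⟨X, hX⟩ : ∃ X, X = Real.exp (Real.log y ^ 2 / 8) := ⟨_, rfl⟩
  have hX1 : 1 ≤ X := hX ▸ Real.one_le_exp (by positivity)
  have hexp : X ^ 3 * N ^ 2 * Real.exp (-y ^ n / 2) ≤ 1 := by
    have hlog0 : 0 ≤ Real.log y := Real.log_nonneg (by linarith)
    have hlog : Real.log y ≤ y := by linarith [Real.log_le_sub_one_of_pos hy0]
    have hlog2 : Real.log y ^ 2 ≤ y ^ 2 := by gcongr
    have hnlog : 4 * n * Real.log y ≤ y * y := mul_le_mul (by linarith) hlog hlog0 hy0.le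
    have hcube : 4 * y ^ 2 ≤ y ^ n :=
      (by nlinarith [sq_nonneg y] : 4 * y ^ 2 ≤ y ^ 3).trans (pow_le_pow_right₀ (by linarith) hn)
    rw [hN, ← pow_mul, ← Real.exp_log (pow_pos hy0 (2 * n * 2)), Real.log_pow, hX,
      ← Real.exp_nat_mul, ← Real.exp_add, ← Real.exp_add, Real.exp_le_one_iff]
    push_cast
    nlinarith
  rw [le_div_iff₀ (by positivity)]
  rw [← hX] at hRy
  have hNR : 1 + N * R ^ 2 ≤ 2 * (N * X ^ 2) := by
    have hle : N * R ^ 2 ≤ N * X ^ 2 := by gcongr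
    nlinarith
  calc R * Real.exp (-y ^ n / 2) * (N * (1 + N * R ^ 2))
      ≤ X * Real.exp (-y ^ n / 2) * (N * (2 * (N * X ^ 2))) := by gcongr
    _ = 2 * (X ^ 3 * N ^ 2 * Real.exp (-y ^ n / 2)) := by ring
    _ ≤ 2 := by linarith

lemma div_one_add_mul_pow_four_le {y N R δ : ℝ} {n : ℕ} (hy : Real.exp (64 * n) ≤ y)
    (hN : N = y ^ (2 * n)) (hδ : Real.exp (-(Real.log y ^ 2 / 64)) ≤ δ)
    (hRy : Real.exp (Real.log y ^ 2 / 8) ≤ R) :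
    R / (1 + δ * R) ^ 4 ≤ 2 / (N * (1 + N * R ^ 2)) := by
  have hy1 : 1 ≤ y := (Real.one_le_exp (by positivity)).trans hy
  have hy0 : 0 < y := by linarith
  have hlog : 64 * n ≤ Real.log y := (Real.le_log_iff_exp_le hy0).2 hy
  have hN1 : 1 ≤ N := hN ▸ one_le_pow₀ hy1
  have hR1 : 1 ≤ R := (Real.one_le_exp (by positivity)).trans hRy
  have hδ0 : 0 < δ := (Real.exp_pos _).trans_le hδ
  have hNδ : N ^ 2 ≤ δ ^ 4 * R := by
    calc N ^ 2 ≤ Real.exp (-(Real.log y ^ 2 / 64)) ^ 4 * Real.exp (Real.log y ^ 2 / 8) := by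
          rw [hN, ← pow_mul, ← Real.exp_log (pow_pos hy0 (2 * n * 2)), Real.log_pow,
            ← Real.exp_nat_mul, ← Real.exp_add, Real.exp_le_exp]
          push_cast
          nlinarith
      _ ≤ δ ^ 4 * R := by gcongr
  rw [div_le_div_iff₀ (by positivity) (by positivity)]
  have hNR : 1 + N * R ^ 2 ≤ 2 * (N * R ^ 2) := by nlinarith
  calc R * (N * (1 + N * R ^ 2)) ≤ R * (N * (2 * (N * R ^ 2))) := by gcongr
    _ = 2 * (R ^ 3 * N ^ 2) := by ring
    _ ≤ 2 * (R ^ 3 * (δ ^ 4 * R)) := by gcongr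
    _ = 2 * (δ * R) ^ 4 := by ring
    _ ≤ 2 * (1 + δ * R) ^ 4 := by gcongr; linarith

lemma div_one_add_mul_pow_le {x δ R : ℝ} (hx : 0 ≤ x) (hδ : 0 ≤ δ) (hR : 0 ≤ R) (n : ℕ) :
    x / (1 + δ * R) ^ n ≤ x :=
  div_le_self hx (one_le_pow₀ (by nlinarith))

namespace IsDiophantineWalk

variable {ι : Type*} [Fintype ι] {p : ι → ℝ} {g : ι → RigidMotion} {α : 𝕋} {M : ℕ}

lemma exists_mul_norm_transferOp_pow_one_le (h : IsDiophantineWalk p g α M) {ρ : ℝ} (hρ : 0 < ρ) :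
    ∃ y₀ : ℝ, ∀ y, y₀ ≤ y → ∀ N : ℕ, (N : ℝ) = y ^ (8 * M + 32) →
      ∀ δ, Real.exp (-(Real.log y ^ 2 / 64)) ≤ δ → ∀ R, ρ ≤ R →
        R * (‖(transferOp p g R ^ N) 1‖ / (1 + δ * R) ^ 4) ≤ 2 / (N * (1 + N * R ^ 2)) := by
  obtain ⟨y₀, hy₀⟩ := h.exists_norm_transferOp_pow_sq_le hρ
  have hone : ‖(1 : CircleL2)‖ ≤ 1 := CircleL2.norm_le_of_forall_norm_le fun x => by simp
  refine ⟨max y₀ (Real.exp (64 * (4 * M + 16 : ℕ))), fun y hy N hN δ hδ R hρR => ?_⟩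
  obtain ⟨hyy₀, hy⟩ := max_le_iff.1 hy
  have hR : 0 < R := hρ.trans_le hρR
  have hδ0 : 0 < δ := (Real.exp_pos _).trans_le hδ
  have hN2 : (N : ℝ) = y ^ (2 * (4 * M + 16)) := by rw [hN]; ring_nf
  rcases le_total R (Real.exp (Real.log y ^ 2 / 8)) with hRy | hRy
  · have hdecay : ‖(transferOp p g R ^ N) 1‖ ≤ Real.exp (-y ^ (4 * M + 16) / 2) := by
      refine le_of_sq_le_sq ((hy₀ y hyy₀ N hN R hρR hRy 1).trans ?_) (Real.exp_nonneg _)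
      rw [← Real.exp_nat_mul, Nat.cast_two, mul_div_cancel₀ _ two_ne_zero]
      exact mul_le_of_le_one_right (Real.exp_nonneg _) (pow_le_one₀ (norm_nonneg _) hone)
    calc R * (‖(transferOp p g R ^ N) 1‖ / (1 + δ * R) ^ 4)
        ≤ R * Real.exp (-y ^ (4 * M + 16) / 2) := by
          gcongr
          exact (div_one_add_mul_pow_le (norm_nonneg _) hδ0.le hR.le 4).trans hdecay
      _ ≤ _ := mul_exp_neg_pow_le (by omega) hy hN2 hR hRy
  · have hle : ‖(transferOp p g R ^ N) 1‖ ≤ 1 :=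
      (norm_pow_apply_le (norm_transferOp_apply_le h.mem_stdSimplex R) N 1).trans hone
    calc R * (‖(transferOp p g R ^ N) 1‖ / (1 + δ * R) ^ 4)
        ≤ R * (1 / (1 + δ * R) ^ 4) := by gcongr
      _ = R / (1 + δ * R) ^ 4 := mul_one_div _ _
      _ ≤ _ := div_one_add_mul_pow_four_le hy hN2 hδ hRy

lemma exists_mul_norm_transferOp_pow_one_sub_le (h : IsDiophantineWalk p g α M)
    (hmean : ∑ i, p i • (g i).trans = 0) (hv : 0 < stepVariance p g)
    (hangle : ∑ i, p i • ((g i).angle.toCircle : ℂ) ^ 2 ≠ 1) :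
    ∃ C > 0, ∃ y₀ : ℝ, ∀ y, y₀ ≤ y → ∀ N : ℕ, (N : ℝ) = y ^ (8 * M + 32) →
      ∀ δ, Real.exp (-(Real.log y ^ 2 / 64)) ≤ δ → ∀ R, 0 < R →
        R * (‖(transferOp p g R ^ N) 1 -
            Real.exp (-(stepVariance p g * N * R ^ 2 / 2)) • (1 : CircleL2)‖ / (1 + δ * R) ^ 4)
          ≤ C / (N * (1 + N * R ^ 2)) := by
  obtain ⟨ρ, hρ, hdecay⟩ := h.exists_norm_transferOp_pow_le
  obtain ⟨C₁, hC₁, c₁, hc₁, hlow⟩ :=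
    exists_norm_transferOp_pow_one_sub_le h.mem_stdSimplex hmean hv hangle hρ hdecay
  obtain ⟨y₀, hhigh⟩ := h.exists_mul_norm_transferOp_pow_one_le hρ
  obtain ⟨C₂, hC₂, hC₂b⟩ := exists_mul_add_mul_exp_le hC₁ hc₁ hρ
  obtain ⟨C₃, hC₃, hC₃b⟩ := exists_mul_exp_le hv hρ
  refine ⟨C₂ + (2 + C₃), by positivity, max y₀ 1, fun y hy N hN δ hδ R hR => ?_⟩
  obtain ⟨hyy₀, hy1⟩ := max_le_iff.1 hy
  have hN0 : 0 < N := Nat.cast_pos.1 (hN ▸ by positivity : (0 : ℝ) < N)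
  have hδ0 : 0 < δ := (Real.exp_pos _).trans_le hδ
  obtain ⟨E, hE⟩ : ∃ E, E = Real.exp (-(stepVariance p g * N * R ^ 2 / 2)) := ⟨_, rfl⟩
  rcases le_total R ρ with hRρ | hρR
  · calc R * (‖(transferOp p g R ^ N) 1 -
            Real.exp (-(stepVariance p g * N * R ^ 2 / 2)) • (1 : CircleL2)‖ / (1 + δ * R) ^ 4)
        ≤ R * (C₁ * (N * R ^ 3 + R ^ 2) * Real.exp (-c₁ * N * R ^ 2)) := by
          gcongr
          exact (div_one_add_mul_pow_le (norm_nonneg _) hδ0.le hR.le 4).trans (hlow R hR.le hRρ N)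
      _ ≤ C₂ / (N * (1 + N * R ^ 2)) := hC₂b R N hR hRρ hN0
      _ ≤ _ := by gcongr; linarith
  · have hsub : ‖(transferOp p g R ^ N) 1 - E • (1 : CircleL2)‖
        ≤ ‖(transferOp p g R ^ N) 1‖ + E := by
      refine (norm_sub_le _ _).trans (add_le_add_right ?_ _)
      have hE0 : 0 ≤ E := hE ▸ Real.exp_nonneg _
      rw [norm_smul, Real.norm_of_nonneg hE0]
      exact mul_le_of_le_one_right hE0 (CircleL2.norm_le_of_forall_norm_le fun x => by simp)
    rw [← hE]
    calc R * (‖(transferOp p g R ^ N) 1 - E • (1 : CircleL2)‖ / (1 + δ * R) ^ 4)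
        ≤ R * ((‖(transferOp p g R ^ N) 1‖ + E) / (1 + δ * R) ^ 4) := by gcongr
      _ = R * (‖(transferOp p g R ^ N) 1‖ / (1 + δ * R) ^ 4) + R * (E / (1 + δ * R) ^ 4) := by ring
      _ ≤ 2 / (N * (1 + N * R ^ 2)) + C₃ / (N * (1 + N * R ^ 2)) := by
        refine add_le_add (hhigh y hyy₀ N hN δ hδ R hρR) (le_trans ?_ (hC₃b R N hρR hN0))
        rw [hE]
        gcongr
        exact div_one_add_mul_pow_le (Real.exp_nonneg _) hδ0.le hR.le 4
      _ = (2 + C₃) / (N * (1 + N * R ^ 2)) := (add_div _ _ _).symm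
      _ ≤ _ := div_le_div_of_nonneg_right (by linarith) (by positivity)

end IsDiophantineWalk

/-! ### Integration in polar coordinates -/

lemma toCircle_coe_eq_cos_add_sin (t : ℝ) :
    (AddCircle.toCircle (t : 𝕋) : ℂ) = Real.cos t + Real.sin t * Complex.I := by
  rw [toCircle_coe, Circle.coe_exp, Complex.exp_mul_I, Complex.ofReal_cos, Complex.ofReal_sin]

lemma ofReal_two_pi_mul_lintegral_haarAddCircle {f : 𝕋 → ℝ≥0∞} (hf : Measurable f) :
    ENNReal.ofReal (2 * Real.pi) * ∫⁻ x, f x ∂AddCircle.haarAddCircle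
      = ∫⁻ t in Set.Ioo (-Real.pi) Real.pi, f (t : 𝕋) := by
  rw [← smul_eq_mul, ← lintegral_smul_measure, ← AddCircle.volume_eq_smul_haarAddCircle,
    ← (AddCircle.measurePreserving_mk (2 * Real.pi) (-Real.pi)).lintegral_comp hf,
    show -Real.pi + 2 * Real.pi = Real.pi by ring, ← restrict_Ioo_eq_restrict_Ioc]

lemma lintegral_eq_lintegral_polar {f : ℂ → ℝ≥0∞} (hf : Measurable f) :
    ∫⁻ z, f z = ENNReal.ofReal (2 * Real.pi) * ∫⁻ R in Set.Ioi (0 : ℝ),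
      ENNReal.ofReal R * ∫⁻ x : 𝕋, f (R * (x.toCircle : ℂ)) ∂AddCircle.haarAddCircle := by
  rw [← Complex.lintegral_comp_polarCoord_symm f, polarCoord_target, Measure.volume_eq_prod,
    ← Measure.prod_restrict, lintegral_prod, ← lintegral_const_mul' _ _ ENNReal.ofReal_ne_top]
  · refine lintegral_congr fun R => ?_
    have hm : Measurable fun x : 𝕋 => f (R * (x.toCircle : ℂ)) :=
      hf.comp (by fun_prop : Continuous fun x : 𝕋 => (R : ℂ) * (x.toCircle : ℂ)).measurable
    rw [mul_left_comm, ofReal_two_pi_mul_lintegral_haarAddCircle hm,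
      ← lintegral_const_mul' _ _ ENNReal.ofReal_ne_top]
    simp only [Complex.polarCoord_symm_apply, smul_eq_mul, toCircle_coe_eq_cos_add_sin]
  · refine Measurable.aemeasurable ?_
    simp only [Complex.polarCoord_symm_apply, smul_eq_mul]
    exact (ENNReal.measurable_ofReal.comp measurable_fst).mul (hf.comp (by fun_prop))

lemma lintegral_inv_one_add_mul_sq_le {C N : ℝ} (hC : 0 ≤ C) (hN : 0 < N) :
    ∫⁻ R in Set.Ioi (0 : ℝ), ENNReal.ofReal (C / (N * (1 + N * R ^ 2)))
      ≤ ENNReal.ofReal (C * Real.pi / (N * Real.sqrt N)) := by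
  have hs : 0 < Real.sqrt N := Real.sqrt_pos.2 hN
  have hscale : ∀ R : ℝ, C / (N * (1 + N * R ^ 2)) = C / N * (1 + (Real.sqrt N * R) ^ 2)⁻¹ := by
    intro R
    rw [mul_pow, Real.sq_sqrt hN.le, ← div_eq_mul_inv, div_div]
  have hInt : Integrable fun R : ℝ => C / N * (1 + (Real.sqrt N * R) ^ 2)⁻¹ :=
    (integrable_inv_one_add_sq.comp_mul_left' hs.ne').const_mul _
  calc ∫⁻ R in Set.Ioi (0 : ℝ), ENNReal.ofReal (C / (N * (1 + N * R ^ 2)))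
      ≤ ∫⁻ R : ℝ, ENNReal.ofReal (C / (N * (1 + N * R ^ 2))) := setLIntegral_le_lintegral _ _
    _ = ENNReal.ofReal (∫ R : ℝ, C / N * (1 + (Real.sqrt N * R) ^ 2)⁻¹) := by
        simp_rw [hscale]
        rw [ofReal_integral_eq_lintegral_ofReal hInt]
        exact .of_forall fun R => by positivity
    _ = _ := by
        rw [integral_const_mul, Measure.integral_comp_mul_left (fun x : ℝ => (1 + x ^ 2)⁻¹),
          integral_univ_inv_one_add_sq, abs_of_pos (inv_pos.2 hs), smul_eq_mul]
        congr 1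
        field_simp

lemma lintegral_ofReal_norm_le (F : CircleL2) :
    ∫⁻ x, ENNReal.ofReal ‖F x‖ ∂AddCircle.haarAddCircle ≤ ENNReal.ofReal ‖F‖ := by
  rw [← ofReal_integral_eq_lintegral_ofReal
    (integrable_haarAddCircle_of_continuous (map_continuous F).norm)
    (.of_forall fun x => norm_nonneg _)]
  exact ENNReal.ofReal_le_ofReal (CircleL2.integral_norm_le_norm F)

lemma integral_norm_div_le_of_radial_bound {φ : ℂ → ℂ} (hφ : Continuous φ) {F : ℝ → CircleL2}
    (hF : ∀ R : ℝ, 0 < R → ∀ x : 𝕋, φ (R * (x.toCircle : ℂ)) = F R x) {C N δ : ℝ} (hC : 0 ≤ C)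
    (hN : 0 < N) (hδ : 0 < δ)
    (hb : ∀ R, 0 < R → R * (‖F R‖ / (1 + δ * R) ^ 4) ≤ C / (N * (1 + N * R ^ 2))) :
    ∫ z, ‖φ z‖ / (1 + δ * ‖z‖) ^ 4 ≤ 2 * Real.pi * (C * Real.pi / (N * Real.sqrt N)) := by
  have hcont : Continuous fun z => ‖φ z‖ / (1 + δ * ‖z‖) ^ 4 := by
    fun_prop (disch := exact fun z => by positivity)
  rw [integral_eq_lintegral_of_nonneg_ae (.of_forall fun z => by positivity)
    hcont.aestronglyMeasurable]
  refine ENNReal.toReal_le_of_le_ofReal (by positivity) ?_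
  rw [lintegral_eq_lintegral_polar hcont.measurable.ennreal_ofReal,
    ENNReal.ofReal_mul Real.two_pi_pos.le]
  refine mul_le_mul_right (le_trans ?_ (lintegral_inv_one_add_mul_sq_le hC hN)) _
  refine setLIntegral_mono' measurableSet_Ioi fun R hR => ?_
  have hR : 0 < R := hR
  have hcircle : ∀ x : 𝕋,
      ENNReal.ofReal (‖φ (R * (x.toCircle : ℂ))‖ / (1 + δ * ‖(R : ℂ) * (x.toCircle : ℂ)‖) ^ 4)
        = ENNReal.ofReal ((1 + δ * R) ^ 4)⁻¹ * ENNReal.ofReal ‖F R x‖ := fun x => by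
    rw [hF R hR, norm_mul, Circle.norm_coe, Complex.norm_of_nonneg hR.le, mul_one,
      div_eq_inv_mul, ENNReal.ofReal_mul (by positivity)]
  simp_rw [hcircle]
  rw [lintegral_const_mul' _ _ ENNReal.ofReal_ne_top]
  calc ENNReal.ofReal R * (ENNReal.ofReal ((1 + δ * R) ^ 4)⁻¹ *
        ∫⁻ x, ENNReal.ofReal ‖F R x‖ ∂AddCircle.haarAddCircle)
      ≤ ENNReal.ofReal R * (ENNReal.ofReal ((1 + δ * R) ^ 4)⁻¹ * ENNReal.ofReal ‖F R‖) := by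
        gcongr
        exact lintegral_ofReal_norm_le _
    _ = ENNReal.ofReal (R * (‖F R‖ / (1 + δ * R) ^ 4)) := by
        rw [← ENNReal.ofReal_mul (by positivity), ← ENNReal.ofReal_mul hR.le, div_eq_inv_mul]
    _ ≤ _ := ENNReal.ofReal_le_ofReal (hb R hR)

/-! ### Smoothing -/

/-- A smooth probability density on the plane supported in the unit ball. -/
noncomputable def smoothingKernel (x : ℂ) : ℝ :=
  (⟨1 / 2, 1, by norm_num, by norm_num⟩ : ContDiffBump (0 : ℂ)).normed volume x

lemma smoothingKernel_nonneg (x : ℂ) : 0 ≤ smoothingKernel x := ContDiffBump.nonneg_normed _ x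

@[fun_prop]
lemma continuous_smoothingKernel : Continuous smoothingKernel := ContDiffBump.continuous_normed _

lemma hasCompactSupport_smoothingKernel : HasCompactSupport smoothingKernel :=
  ContDiffBump.hasCompactSupport_normed _

lemma smoothingKernel_eq_zero {x : ℂ} (hx : 1 ≤ ‖x‖) : smoothingKernel x = 0 := by
  have hsupp : Function.support smoothingKernel = Metric.ball 0 1 :=
    ContDiffBump.support_normed_eq _
  rw [← Function.notMem_support, hsupp, mem_ball_zero_iff]
  exact not_lt.2 hx

lemma exists_smoothingKernel_eq_integral : ∃ k : ℂ → ℂ, Integrable k ∧ Continuous k ∧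
    (∃ C > 0, ∀ w, ‖k w‖ ≤ C / (1 + ‖w‖) ^ 4) ∧
    ∀ x, (smoothingKernel x : ℂ) = ∫ w, Circle.exp (2 * Real.pi * inner ℝ w x) * k w := by
  have hsupp : HasCompactSupport fun x => (smoothingKernel x : ℂ) :=
    hasCompactSupport_smoothingKernel.comp_left Complex.ofReal_zero
  have hsmooth : ContDiff ℝ ((⊤ : ℕ∞) : WithTop ℕ∞) fun x => (smoothingKernel x : ℂ) :=
    Complex.ofRealCLM.contDiff.comp (ContDiffBump.contDiff_normed _)
  obtain ⟨S, hS⟩ : ∃ S : SchwartzMap ℂ ℂ, ∀ x, S x = smoothingKernel x :=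
    ⟨hsupp.toSchwartzMap hsmooth, fun _ => rfl⟩
  refine ⟨⇑(𝓕 S : SchwartzMap ℂ ℂ), (𝓕 S).integrable, (𝓕 S).continuous, ?_, fun x => ?_⟩
  · have hdecay := fun w => SchwartzMap.one_add_le_sup_seminorm_apply (𝕜 := ℝ) (m := (4, 0))
      (k := 4) (n := 0) le_rfl le_rfl (𝓕 S) w
    simp only [norm_iteratedFDeriv_zero] at hdecay
    set K := 2 ^ 4 * ((Finset.Iic ((4, 0) : ℕ × ℕ)).sup
      fun m => SchwartzMap.seminorm ℝ m.1 m.2) (𝓕 S)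
    refine ⟨|K| + 1, by positivity, fun w => ?_⟩
    rw [le_div_iff₀ (by positivity), mul_comm]
    exact (hdecay w).trans (by linarith [le_abs_self K])
  · have hinv : 𝓕⁻ (𝓕 S) = S := FourierTransform.fourierInv_fourier_eq S
    conv_lhs => rw [← hS, ← hinv]
    rw [SchwartzMap.fourierInv_coe, Real.fourierInv_eq']
    simp only [Circle.coe_exp, smul_eq_mul]

/-- The integral against `μ` of the kernel rescaled to radius `δ` and recentred at `x`, that is
`δ ^ 2` times the density at `x` of the measure `μ` smoothed at scale `δ`. -/
noncomputable def smoothedDensity (μ : Measure ℂ) (δ : ℝ) (x : ℂ) : ℝ :=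
  ∫ y, smoothingKernel (δ⁻¹ • (x - y)) ∂μ

/-- The distance between the characteristic functions of `μ` and `ν`, with a weight which is
integrable on the plane and discards the frequencies beyond `δ⁻¹`. -/
noncomputable def charFunDist (μ ν : Measure ℂ) (δ : ℝ) : ℝ :=
  ∫ z, ‖charFun μ z - charFun ν z‖ / (1 + δ * ‖z‖) ^ 4

lemma charFunDist_nonneg (μ ν : Measure ℂ) {δ : ℝ} (hδ : 0 ≤ δ) : 0 ≤ charFunDist μ ν δ :=
  integral_nonneg fun z => by positivity

lemma charFunDist_comm (μ ν : Measure ℂ) (δ : ℝ) : charFunDist μ ν δ = charFunDist ν μ δ := by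
  simp only [charFunDist, norm_sub_rev]

lemma integral_norm_charFun_sub_div (μ ν : Measure ℂ) {δ : ℝ} (hδ : 0 < δ) :
    ∫ w, ‖charFun μ ((-(2 * Real.pi / δ)) • w) - charFun ν ((-(2 * Real.pi / δ)) • w)‖
        / (1 + ‖w‖) ^ 4
      = (δ / (2 * Real.pi)) ^ 2 * charFunDist μ ν (δ / (2 * Real.pi)) := by
  have hscale := Measure.integral_comp_smul volume
    (fun z => ‖charFun μ z - charFun ν z‖ / (1 + δ / (2 * Real.pi) * ‖z‖) ^ 4)
    (-(2 * Real.pi / δ))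
  have hnorm : ∀ w : ℂ, δ / (2 * Real.pi) * ‖(-(2 * Real.pi / δ)) • w‖ = ‖w‖ := fun w => by
    rw [norm_smul, norm_neg, Real.norm_of_nonneg (by positivity)]
    field_simp
  simp only [hnorm] at hscale
  rw [hscale, Complex.finrank_real_complex, smul_eq_mul, charFunDist, neg_sq, ← inv_pow, inv_div,
    abs_of_pos (by positivity)]

section Fourier

variable (μ ν : Measure ℂ) [IsProbabilityMeasure μ] [IsProbabilityMeasure ν]

lemma smoothedDensity_eq_integral {k : ℂ → ℂ} (hki : Integrable k) (hkc : Continuous k)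
    (hk : ∀ x, (smoothingKernel x : ℂ) = ∫ w, Circle.exp (2 * Real.pi * inner ℝ w x) * k w)
    (δ : ℝ) (x : ℂ) :
    (smoothedDensity μ δ x : ℂ) = ∫ w, Circle.exp (2 * Real.pi * inner ℝ w (δ⁻¹ • x)) * k w
      * charFun μ ((-(2 * Real.pi / δ)) • w) := by
  rw [smoothedDensity, ← integral_complex_ofReal]
  simp_rw [hk]
  rw [integral_integral_swap]
  · refine integral_congr_ae (.of_forall fun w => ?_)
    simp only
    rw [charFun_apply, ← integral_const_mul]
    refine integral_congr_ae (.of_forall fun y => ?_)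
    have hphase : 2 * Real.pi * inner ℝ w (δ⁻¹ • (x - y))
        = 2 * Real.pi * inner ℝ w (δ⁻¹ • x) + inner ℝ y ((-(2 * Real.pi / δ)) • w) := by
      rw [smul_sub, inner_sub_right, real_inner_smul_right _ _ δ⁻¹, real_inner_smul_right _ _ δ⁻¹,
        real_inner_smul_right, real_inner_comm w y]
      ring
    simp only [hphase, Circle.exp_add, Circle.coe_mul, ← Circle.coe_exp]
    ring
  · have hprod : Integrable (fun q : ℂ × ℂ => k q.2) (μ.prod volume) := hki.comp_snd μ
    refine hprod.mono (Continuous.aestronglyMeasurable ?_) (.of_forall fun q => ?_)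
    · simp only [Function.uncurry_def]
      fun_prop
    · simp only [Function.uncurry_def, norm_mul, Circle.norm_coe, one_mul, le_refl]

lemma integrable_mul_charFun {k : ℂ → ℂ} (hki : Integrable k) (hkc : Continuous k) (x : ℂ)
    (s : ℝ) : Integrable fun w => Circle.exp (2 * Real.pi * inner ℝ w x) * k w
      * charFun μ (s • w) := by
  refine hki.mono (Continuous.aestronglyMeasurable (by fun_prop)) (.of_forall fun w => ?_)
  rw [norm_mul, norm_mul, Circle.norm_coe, one_mul]
  exact mul_le_of_le_one_right (norm_nonneg _) (norm_charFun_le_one _)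

lemma integrable_inv_one_add_norm_pow : Integrable fun w : ℂ => ((1 + ‖w‖) ^ 4)⁻¹ := by
  have h := integrable_one_add_norm (E := ℂ) (μ := volume) (r := 4)
    (by rw [Complex.finrank_real_complex]; norm_num)
  refine h.congr (.of_forall fun w => ?_)
  simp only
  rw [Real.rpow_neg (by positivity)]
  norm_cast

lemma integrable_norm_charFun_sub_div (s : ℝ) :
    Integrable fun w : ℂ => ‖charFun μ (s • w) - charFun ν (s • w)‖ / (1 + ‖w‖) ^ 4 := by
  refine (integrable_inv_one_add_norm_pow.const_mul 2).mono
    (Continuous.aestronglyMeasurable ?_) (.of_forall fun w => ?_)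
  · fun_prop (disch := exact fun w => by positivity)
  · rw [div_eq_mul_inv, norm_mul, norm_mul, norm_norm, Real.norm_of_nonneg zero_le_two]
    gcongr
    refine (norm_sub_le _ _).trans ?_
    linarith [norm_charFun_le_one (μ := μ) (s • w), norm_charFun_le_one (μ := ν) (s • w)]

end Fourier

lemma exists_abs_smoothedDensity_sub_le : ∃ C > 0, ∀ (μ ν : Measure ℂ) [IsProbabilityMeasure μ]
    [IsProbabilityMeasure ν] (δ : ℝ), 0 < δ → ∀ x : ℂ,
    |smoothedDensity μ δ x - smoothedDensity ν δ x|
      ≤ δ ^ 2 * (C * charFunDist μ ν (δ / (2 * Real.pi))) := by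
  obtain ⟨k, hki, hkc, ⟨C, hC, hkC⟩, hk⟩ := exists_smoothingKernel_eq_integral
  refine ⟨C / (2 * Real.pi) ^ 2, by positivity, fun μ ν _ _ δ hδ x => ?_⟩
  rw [← Real.norm_eq_abs, ← Complex.norm_real, Complex.ofReal_sub,
    smoothedDensity_eq_integral μ hki hkc hk, smoothedDensity_eq_integral ν hki hkc hk,
    ← integral_sub (integrable_mul_charFun μ hki hkc _ _) (integrable_mul_charFun ν hki hkc _ _)]
  refine (norm_integral_le_of_norm_le
    ((integrable_norm_charFun_sub_div μ ν (-(2 * Real.pi / δ))).const_mul C)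
    (.of_forall fun w => ?_)).trans (le_of_eq ?_)
  · rw [← mul_sub, norm_mul, norm_mul, Circle.norm_coe, one_mul, mul_div_left_comm, mul_comm]
    gcongr
    exact hkC w
  · rw [integral_const_mul, integral_norm_charFun_sub_div μ ν hδ]
    ring

section Balls

variable (μ : Measure ℂ) [IsProbabilityMeasure μ] {δ : ℝ}

lemma smoothingKernel_smul_sub_eq_zero (hδ : 0 < δ) {x y : ℂ} (h : δ ≤ dist x y) :
    smoothingKernel (δ⁻¹ • (x - y)) = 0 := by
  refine smoothingKernel_eq_zero ?_
  rw [norm_smul, norm_inv, Real.norm_of_nonneg hδ.le, inv_mul_eq_div, one_le_div hδ,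
    ← dist_eq_norm]
  exact h

lemma integral_smoothingKernel_smul_sub (hδ : 0 < δ) (y : ℂ) :
    ∫ x, smoothingKernel (δ⁻¹ • (x - y)) = δ ^ 2 := by
  have hone : ∫ x, smoothingKernel x = 1 := ContDiffBump.integral_normed _
  rw [integral_sub_right_eq_self (fun x => smoothingKernel (δ⁻¹ • x)) y,
    Measure.integral_comp_smul, Complex.finrank_real_complex, hone, inv_pow, inv_inv, smul_eq_mul,
    mul_one, abs_of_pos (by positivity)]

lemma setIntegral_smoothingKernel_le (hδ : 0 < δ) (x₀ y : ℂ) (s : ℝ) :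
    ∫ x in Metric.ball x₀ s, smoothingKernel (δ⁻¹ • (x - y))
      ≤ (Metric.ball x₀ (s + δ)).indicator (fun _ => δ ^ 2) y := by
  by_cases hy : y ∈ Metric.ball x₀ (s + δ)
  · have hint : Integrable fun x => smoothingKernel (δ⁻¹ • (x - y)) :=
      ((continuous_smoothingKernel.integrable_of_hasCompactSupport
        hasCompactSupport_smoothingKernel).comp_smul (inv_ne_zero hδ.ne')).comp_sub_right y
    rw [Set.indicator_of_mem hy, ← integral_smoothingKernel_smul_sub hδ y]
    exact setIntegral_le_integral hint (.of_forall fun x => smoothingKernel_nonneg _)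
  · rw [Set.indicator_of_notMem hy]
    refine (setIntegral_eq_zero_of_forall_eq_zero fun x hx => ?_).le
    refine smoothingKernel_smul_sub_eq_zero hδ ?_
    rw [Metric.mem_ball] at hx hy
    linarith [dist_triangle_left y x₀ x]

lemma le_setIntegral_smoothingKernel (hδ : 0 < δ) (x₀ y : ℂ) (s : ℝ) :
    (Metric.ball x₀ s).indicator (fun _ => δ ^ 2) y
      ≤ ∫ x in Metric.ball x₀ (s + δ), smoothingKernel (δ⁻¹ • (x - y)) := by
  by_cases hy : y ∈ Metric.ball x₀ s
  · rw [Set.indicator_of_mem hy, ← integral_smoothingKernel_smul_sub hδ y]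
    refine (setIntegral_eq_integral_of_forall_compl_eq_zero fun x hx => ?_).ge
    refine smoothingKernel_smul_sub_eq_zero hδ ?_
    rw [Metric.mem_ball] at hx hy
    linarith [dist_triangle x y x₀]
  · rw [Set.indicator_of_notMem hy]
    exact setIntegral_nonneg measurableSet_ball fun x _ => smoothingKernel_nonneg _

lemma integrable_smoothingKernel_prod (x₀ : ℂ) (s : ℝ) :
    Integrable (fun q : ℂ × ℂ => smoothingKernel (δ⁻¹ • (q.1 - q.2)))
      ((volume.restrict (Metric.ball x₀ s)).prod μ) := by
  have : IsFiniteMeasure ((volume : Measure ℂ).restrict (Metric.ball x₀ s)) :=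
    isFiniteMeasure_restrict.2 measure_ball_lt_top.ne
  obtain ⟨K, hK⟩ :=
    hasCompactSupport_smoothingKernel.exists_bound_of_continuous continuous_smoothingKernel
  exact (integrable_const K).mono' (Continuous.aestronglyMeasurable (by fun_prop))
    (.of_forall fun q => hK _)

lemma setIntegral_smoothedDensity_le (hδ : 0 < δ) (x₀ : ℂ) (s : ℝ) :
    ∫ x in Metric.ball x₀ s, smoothedDensity μ δ x
      ≤ δ ^ 2 * μ.real (Metric.ball x₀ (s + δ)) := by
  have hi := integrable_smoothingKernel_prod μ (δ := δ) x₀ s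
  simp only [smoothedDensity]
  rw [integral_integral_swap hi, mul_comm, ← smul_eq_mul,
    ← integral_indicator_const _ measurableSet_ball]
  exact integral_mono hi.integral_prod_right ((integrable_const _).indicator measurableSet_ball)
    fun y => setIntegral_smoothingKernel_le hδ x₀ y s

lemma le_setIntegral_smoothedDensity (hδ : 0 < δ) (x₀ : ℂ) (s : ℝ) :
    δ ^ 2 * μ.real (Metric.ball x₀ s)
      ≤ ∫ x in Metric.ball x₀ (s + δ), smoothedDensity μ δ x := by
  have hi := integrable_smoothingKernel_prod μ (δ := δ) x₀ (s + δ)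
  simp only [smoothedDensity]
  rw [integral_integral_swap hi, mul_comm, ← smul_eq_mul,
    ← integral_indicator_const _ measurableSet_ball]
  exact integral_mono ((integrable_const _).indicator measurableSet_ball) hi.integral_prod_right
    fun y => le_setIntegral_smoothingKernel hδ x₀ y s

lemma integrableOn_smoothedDensity (x₀ : ℂ) (s : ℝ) :
    IntegrableOn (smoothedDensity μ δ) (Metric.ball x₀ s) :=
  (integrable_smoothingKernel_prod μ x₀ s).integral_prod_left

end Balls

lemma volume_real_ball (x : ℂ) {r : ℝ} (hr : 0 ≤ r) :
    (volume : Measure ℂ).real (Metric.ball x r) = Real.pi * r ^ 2 := by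
  rw [Measure.real, Complex.volume_ball, ENNReal.toReal_mul, ENNReal.toReal_pow,
    ENNReal.toReal_ofReal hr, ENNReal.coe_toReal, NNReal.coe_real_pi, mul_comm]

lemma measureReal_ball_le_add (μ ν : Measure ℂ) [IsProbabilityMeasure μ] [IsProbabilityMeasure ν]
    {δ K r : ℝ} (hδ : 0 < δ) (hr : 0 ≤ r)
    (hK : ∀ x, |smoothedDensity μ δ x - smoothedDensity ν δ x| ≤ δ ^ 2 * K) (x₀ : ℂ) :
    μ.real (Metric.ball x₀ r)
      ≤ ν.real (Metric.ball x₀ (r + 2 * δ)) + K * (Real.pi * (r + δ) ^ 2) := by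
  have hsub : (∫ x in Metric.ball x₀ (r + δ), smoothedDensity μ δ x)
      ≤ (∫ x in Metric.ball x₀ (r + δ), smoothedDensity ν δ x)
        + δ ^ 2 * K * (Real.pi * (r + δ) ^ 2) := by
    rw [← sub_le_iff_le_add', ← integral_sub (integrableOn_smoothedDensity μ x₀ _)
      (integrableOn_smoothedDensity ν x₀ _), ← volume_real_ball x₀ (by linarith : 0 ≤ r + δ)]
    exact (Real.le_norm_self _).trans
      (norm_setIntegral_le_of_norm_le_const measure_ball_lt_top fun x _ => hK x)
  refine le_of_mul_le_mul_left ?_ (by positivity : 0 < δ ^ 2)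
  have hlower := le_setIntegral_smoothedDensity μ hδ x₀ r
  have hupper := setIntegral_smoothedDensity_le ν hδ x₀ (r + δ)
  rw [show r + δ + δ = r + 2 * δ by ring] at hupper
  linarith

lemma measureReal_ball_sub_le {ν : Measure ℂ} [IsProbabilityMeasure ν] {D : ℝ} (hD : 0 ≤ D)
    (hν : ν ≤ ENNReal.ofReal D • volume) (x : ℂ) {r s : ℝ} (hr : 0 ≤ r) (hrs : r ≤ s) :
    ν.real (Metric.ball x s) - ν.real (Metric.ball x r) ≤ D * (Real.pi * (s ^ 2 - r ^ 2)) := by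
  have hsub := Metric.ball_subset_ball (x := x) hrs
  have hfin : volume (Metric.ball x s \ Metric.ball x r) ≠ ∞ :=
    ((measure_mono Set.sdiff_subset).trans_lt measure_ball_lt_top).ne
  have hle := ENNReal.toReal_mono (ENNReal.mul_ne_top ENNReal.ofReal_ne_top hfin)
    (hν (Metric.ball x s \ Metric.ball x r))
  rw [ENNReal.toReal_mul, ENNReal.toReal_ofReal hD, ← measureReal_def, ← measureReal_def,
    measureReal_sdiff hsub measurableSet_ball,
    measureReal_sdiff hsub measurableSet_ball measure_ball_lt_top.ne, volume_real_ball x hr,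
    volume_real_ball x (hr.trans hrs)] at hle
  linarith

theorem exists_abs_measureReal_ball_sub_le : ∃ C > 0, ∀ (μ ν : Measure ℂ) [IsProbabilityMeasure μ]
    [IsProbabilityMeasure ν] (D : ℝ), 0 ≤ D → ν ≤ ENNReal.ofReal D • volume →
    ∀ (x₀ : ℂ) (r δ : ℝ), 0 < δ → 2 * δ ≤ r →
    |μ.real (Metric.ball x₀ r) - ν.real (Metric.ball x₀ r)|
      ≤ C * (D * (r * δ) + r ^ 2 * charFunDist μ ν (δ / (2 * Real.pi))) := by
  obtain ⟨C, hC, hdens⟩ := exists_abs_smoothedDensity_sub_le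
  refine ⟨4 * Real.pi * C + 8 * Real.pi, by positivity, fun μ ν _ _ D hD hν x₀ r δ hδ hr => ?_⟩
  obtain ⟨J, hJ⟩ : ∃ J, J = charFunDist μ ν (δ / (2 * Real.pi)) := ⟨_, rfl⟩
  have hJ0 : 0 ≤ J := hJ ▸ charFunDist_nonneg μ ν (by positivity)
  have hupper := measureReal_ball_le_add μ ν hδ (by linarith : 0 ≤ r)
    (fun x => hJ ▸ hdens μ ν δ hδ x) x₀
  have hlower := measureReal_ball_le_add ν μ hδ (by linarith : 0 ≤ r - 2 * δ)
    (fun x => hJ ▸ charFunDist_comm μ ν _ ▸ hdens ν μ δ hδ x) x₀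
  rw [sub_add_cancel, show r - 2 * δ + δ = r - δ by ring] at hlower
  have houter := measureReal_ball_sub_le hD hν x₀ (by linarith : 0 ≤ r)
    (by linarith : r ≤ r + 2 * δ)
  have hinner := measureReal_ball_sub_le hD hν x₀ (by linarith : 0 ≤ r - 2 * δ)
    (by linarith : r - 2 * δ ≤ r)
  have hsq_add : C * J * (Real.pi * (r + δ) ^ 2) ≤ C * J * (Real.pi * (4 * r ^ 2)) := by
    gcongr
    nlinarith
  have hsq_sub : C * J * (Real.pi * (r - δ) ^ 2) ≤ C * J * (Real.pi * (4 * r ^ 2)) := by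
    gcongr
    nlinarith
  have hring_add : D * (Real.pi * ((r + 2 * δ) ^ 2 - r ^ 2)) ≤ D * (Real.pi * (8 * (r * δ))) := by
    gcongr
    nlinarith
  have hring_sub : D * (Real.pi * (r ^ 2 - (r - 2 * δ) ^ 2)) ≤ D * (Real.pi * (8 * (r * δ))) := by
    gcongr
    nlinarith
  have hDr : 0 ≤ Real.pi * C * (D * (r * δ)) := by
    have hr0 : 0 ≤ r := by linarith
    positivity
  have hJr : 0 ≤ Real.pi * (r ^ 2 * J) := by positivity
  rw [← hJ, abs_le]
  constructor <;> linarith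

/-! ### Gaussian laws on the plane -/

lemma gaussianReal_zero_one_le_volume : gaussianReal 0 1 ≤ (volume : Measure ℝ) := by
  rw [gaussianReal_of_var_ne_zero 0 one_ne_zero]
  calc volume.withDensity (gaussianPDF 0 1) ≤ volume.withDensity 1 := by
        refine withDensity_mono (.of_forall fun x => ?_)
        rw [gaussianPDF, Pi.one_apply, ENNReal.ofReal_le_one, gaussianPDFReal_def, NNReal.coe_one,
          mul_one]
        refine mul_le_one₀ (inv_le_one_of_one_le₀ (Real.one_le_sqrt.2 ?_)) (Real.exp_pos _).le
          (Real.exp_le_one_iff.2 ?_)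
        · linarith [Real.pi_gt_three]
        · exact div_nonpos_of_nonpos_of_nonneg (neg_nonpos.2 (sq_nonneg _)) (by norm_num)
    _ = volume := withDensity_one

lemma stdGaussian_complex_eq_map_prod : stdGaussian ℂ
    = ((gaussianReal 0 1).prod (gaussianReal 0 1)).map Complex.measurableEquivRealProd.symm := by
  rw [stdGaussian_eq_map_pi_orthonormalBasis Complex.orthonormalBasisOneI,
    ← (measurePreserving_finTwoArrow (gaussianReal 0 1)).symm.map_eq,
    Measure.map_map (by fun_prop) (MeasurableEquiv.measurable _)]
  congr 1
  ext x : 1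
  simp only [Fin.sum_univ_two, Complex.coe_orthonormalBasisOneI, Matrix.cons_val_zero,
    Matrix.cons_val_one, Complex.real_smul, mul_one]
  exact (Complex.equivRealProdCLM_symm_apply _).symm

lemma stdGaussian_complex_le_volume : stdGaussian ℂ ≤ (volume : Measure ℂ) := by
  rw [stdGaussian_complex_eq_map_prod, ← Complex.volume_preserving_equiv_real_prod.symm.map_eq,
    Measure.volume_eq_prod]
  exact Measure.map_mono
    (Measure.prod_mono gaussianReal_zero_one_le_volume gaussianReal_zero_one_le_volume)
    (MeasurableEquiv.measurable _)

/-- The law of `s Z`, for `Z` a standard Gaussian on the plane. -/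
noncomputable def scaledGaussian (s : ℝ) : Measure ℂ := (stdGaussian ℂ).map (s • ·)

instance isProbabilityMeasure_scaledGaussian (s : ℝ) : IsProbabilityMeasure (scaledGaussian s) :=
  Measure.isProbabilityMeasure_map (by fun_prop)

instance isGaussian_scaledGaussian (s : ℝ) : IsGaussian (scaledGaussian s) :=
  inferInstanceAs
    (IsGaussian ((stdGaussian ℂ).map (s • ContinuousLinearMap.id ℝ ℂ : ℂ →L[ℝ] ℂ)))

lemma charFun_scaledGaussian (s : ℝ) (t : ℂ) :
    charFun (scaledGaussian s) t = Real.exp (-(s ^ 2 * ‖t‖ ^ 2 / 2)) := by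
  rw [scaledGaussian, charFun_map_smul, charFun_stdGaussian, norm_smul,
    ← Complex.ofReal_pow, mul_pow, Real.norm_eq_abs, sq_abs]
  push_cast
  congr 1
  ring

lemma stdGaussian_real_mul_mem (s : ℝ) {B : Set ℂ} (hB : MeasurableSet B) :
    (stdGaussian ℂ).real {z | (s : ℂ) * z ∈ B} = (scaledGaussian s).real B := by
  rw [scaledGaussian, map_measureReal_apply (by fun_prop) hB]
  rfl

lemma scaledGaussian_le {s : ℝ} (hs : s ≠ 0) :
    scaledGaussian s ≤ ENNReal.ofReal (1 / s ^ 2) • volume := by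
  refine Measure.le_iff.2 fun A hA => ?_
  rw [scaledGaussian, Measure.map_apply (by fun_prop) hA, Measure.smul_apply, smul_eq_mul]
  refine (stdGaussian_complex_le_volume _).trans_eq ?_
  rw [Measure.addHaar_preimage_smul _ hs, Complex.finrank_real_complex,
    abs_of_pos (by positivity), one_div]

/-! ### The law of the walk -/

lemma measurable_isom_apply (x : ℂ) : Measurable fun g : ℂ ≃ᵢ ℂ => g x :=
  (measurable_pi_apply x).comp (comap_measurable fun (g : ℂ ≃ᵢ ℂ) (x : ℂ) => g x)

lemma measurable_isom_eval : Measurable fun q : (ℂ ≃ᵢ ℂ) × ℂ => q.1 q.2 :=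
  (measurable_uncurry_of_continuous_of_measurable (u := fun (x : ℂ) (g : ℂ ≃ᵢ ℂ) => g x)
    (fun g => g.continuous) measurable_isom_apply).comp measurable_swap

instance isomMeasurableSingletonClass : MeasurableSingletonClass (ℂ ≃ᵢ ℂ) where
  measurableSet_singleton g := by
    have hdense := TopologicalSpace.denseRange_denseSeq ℂ
    have h : ({g} : Set (ℂ ≃ᵢ ℂ))
        = ⋂ n, {g' | g' (TopologicalSpace.denseSeq ℂ n) = g (TopologicalSpace.denseSeq ℂ n)} := by
      ext g'
      simp only [Set.mem_singleton_iff, Set.mem_iInter, Set.mem_ofPred_eq]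
      refine ⟨fun h n => by rw [h], fun h => IsometryEquiv.ext fun x => ?_⟩
      exact congrFun (hdense.equalizer g'.continuous g.continuous (funext h)) x
    rw [h]
    exact .iInter fun n => measurable_isom_apply _ (measurableSet_singleton _)

lemma walkPoint_zero : walkPoint 0 = fun _ => 0 := by
  ext g : 1
  simp [walkPoint]

lemma walkPoint_succ (N : ℕ) :
    walkPoint (N + 1) = fun g => g 0 (walkPoint N fun j => g j.succ) := by
  ext g : 1
  simp [walkPoint, List.ofFn_succ, IsometryEquiv.mul_apply]

lemma measurable_walkPoint (N : ℕ) : Measurable (walkPoint N) := by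
  induction N with
  | zero => exact walkPoint_zero ▸ measurable_const
  | succ N ih =>
    have htail : Measurable fun (g : Fin (N + 1) → (ℂ ≃ᵢ ℂ)) (j : Fin N) => g j.succ :=
      measurable_pi_lambda _ fun j => measurable_pi_apply j.succ
    rw [walkPoint_succ]
    exact measurable_isom_eval.comp ((measurable_pi_apply 0).prodMk (ih.comp htail))

/-- The law of `Y_N`. -/
noncomputable def walkLaw (μ : PMF (ℂ ≃ᵢ ℂ)) (N : ℕ) : Measure ℂ :=
  (Measure.pi fun _ : Fin N => μ.toMeasure).map (walkPoint N)

instance isProbabilityMeasure_walkLaw (μ : PMF (ℂ ≃ᵢ ℂ)) (N : ℕ) :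
    IsProbabilityMeasure (walkLaw μ N) :=
  Measure.isProbabilityMeasure_map (measurable_walkPoint N).aemeasurable

lemma walkProb_eq_walkLaw_real (μ : PMF (ℂ ≃ᵢ ℂ)) (N : ℕ) {B : Set ℂ} (hB : MeasurableSet B) :
    walkProb μ N B = (walkLaw μ N).real B := by
  rw [walkProb, walkLaw, map_measureReal_apply (measurable_walkPoint N) hB]
  rfl

lemma charFun_walkLaw_zero (μ : PMF (ℂ ≃ᵢ ℂ)) (ξ : ℂ) : charFun (walkLaw μ 0) ξ = 1 := by
  rw [walkLaw, walkPoint_zero, Measure.map_const, measure_univ, one_smul, charFun_dirac,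
    inner_zero_left, Complex.ofReal_zero, zero_mul, Complex.exp_zero]

lemma walkLaw_succ (μ : PMF (ℂ ≃ᵢ ℂ)) (N : ℕ) :
    walkLaw μ (N + 1) = (μ.toMeasure.prod (walkLaw μ N)).map fun q => q.1 q.2 := by
  have hsucc := (measurePreserving_piFinSuccAbove (fun _ : Fin (N + 1) => μ.toMeasure) 0).map_eq
  have hprod := Measure.map_prod_map μ.toMeasure (Measure.pi fun _ : Fin N => μ.toMeasure)
    measurable_id (measurable_walkPoint N)
  have hmeas : Measurable (Prod.map (id : (ℂ ≃ᵢ ℂ) → (ℂ ≃ᵢ ℂ)) (walkPoint N)) :=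
    measurable_id.prodMap (measurable_walkPoint N)
  rw [Measure.map_id] at hprod
  rw [walkLaw, walkLaw, hprod, ← hsucc, Measure.map_map measurable_isom_eval hmeas,
    Measure.map_map (measurable_isom_eval.comp hmeas) (MeasurableEquiv.measurable _),
    walkPoint_succ]
  rfl

lemma charFun_walkLaw_succ (μ : PMF (ℂ ≃ᵢ ℂ)) (N : ℕ) (ξ : ℂ) :
    charFun (walkLaw μ (N + 1)) ξ = ∫ g, charFun ((walkLaw μ N).map g) ξ ∂μ.toMeasure := by
  have hcont : Continuous fun z : ℂ => Complex.exp (inner ℝ z ξ * Complex.I) := by fun_prop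
  have hint : Integrable (fun q : (ℂ ≃ᵢ ℂ) × ℂ => Complex.exp (inner ℝ (q.1 q.2) ξ * Complex.I))
      (μ.toMeasure.prod (walkLaw μ N)) :=
    (integrable_const (1 : ℝ)).mono'
      (hcont.measurable.comp measurable_isom_eval).aestronglyMeasurable
      (.of_forall fun q => (Complex.norm_exp_ofReal_mul_I _).le)
  rw [charFun_apply, walkLaw_succ,
    integral_map measurable_isom_eval.aemeasurable hcont.aestronglyMeasurable,
    integral_prod _ hint]
  refine integral_congr_ae (.of_forall fun g => ?_)
  simp only
  rw [charFun_apply, integral_map g.continuous.aemeasurable hcont.aestronglyMeasurable]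

namespace RigidMotion

/-- The isometry `g` of the plane is the rigid motion `a`. -/
def Represents (a : RigidMotion) (g : ℂ ≃ᵢ ℂ) : Prop :=
  ∀ x : ℂ, g x = a.angle.toCircle * x + a.trans

variable {a b : RigidMotion} {g h : ℂ ≃ᵢ ℂ}

lemma Represents.apply_zero (ha : a.Represents g) : g 0 = a.trans := by
  rw [ha 0, mul_zero, zero_add]

lemma Represents.eq (ha : a.Represents g) (hb : b.Represents g) : a = b := by
  have htrans : a.trans = b.trans := ha.apply_zero.symm.trans hb.apply_zero
  have hangle := (ha 1).symm.trans (hb 1)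
  rw [htrans, mul_one, mul_one, add_left_inj] at hangle
  exact RigidMotion.ext
    (AddCircle.injective_toCircle Real.two_pi_pos.ne' (Subtype.ext hangle)) htrans

lemma Represents.mul (ha : a.Represents g) (hb : b.Represents h) :
    (a * b).Represents (g * h) := fun x => by
  rw [IsometryEquiv.mul_apply, hb x, ha, angle_mul, trans_mul, AddCircle.toCircle_add,
    Circle.coe_mul]
  ring

lemma Represents.charFun_map (ha : a.Represents g) (ν : Measure ℂ) (R : ℝ) (x : 𝕋) :
    charFun (ν.map g) (R * (x.toCircle : ℂ))
      = Circle.exp (R * inner ℝ a.trans (x.toCircle : ℂ))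
        * charFun ν (R * ((x - a.angle).toCircle : ℂ)) := by
  rw [charFun_apply, integral_map g.continuous.aemeasurable
    (Continuous.aestronglyMeasurable (by fun_prop)), charFun_apply, ← integral_const_mul]
  refine integral_congr_ae (.of_forall fun w => ?_)
  simp only
  have hinner : ∀ z ξ : ℂ, inner ℝ z (R * ξ) = R * inner ℝ z ξ := fun z ξ => by
    rw [← Complex.real_smul, real_inner_smul_right]
  rw [ha w, Circle.coe_exp, ← Complex.exp_add, hinner, hinner, inner_add_left,
    inner_toCircle_sub, ← add_mul, ← Complex.ofReal_add, ← mul_add,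
    add_comm (inner ℝ a.trans _)]

end RigidMotion

lemma HasRotationAngle.represents {g : ℂ ≃ᵢ ℂ} {θ : ℝ} (hg : HasRotationAngle g θ) :
    RigidMotion.Represents ⟨θ, g 0⟩ g := fun x => by
  rw [hg x, toCircle_coe, Circle.coe_exp]

lemma toReal_pos_of_support {μ : PMF (ℂ ≃ᵢ ℂ)} (g : μ.support) : 0 < (μ g).toReal :=
  ENNReal.toReal_pos ((PMF.mem_support_iff _ _).1 g.2) (μ.apply_ne_top _)

section FiniteSupport

variable {μ : PMF (ℂ ≃ᵢ ℂ)} [Fintype μ.support]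

lemma integral_toMeasure_eq_sum_support {E : Type*} [NormedAddCommGroup E] [NormedSpace ℝ E]
    [CompleteSpace E] (f : (ℂ ≃ᵢ ℂ) → E) :
    ∫ g, f g ∂μ.toMeasure = ∑ g : μ.support, (μ g).toReal • f g := by
  rw [← PMF.restrict_toMeasure_support, setIntegral_countable f μ.support_countable
    (.of_finite μ.support.toFinite), tsum_fintype]
  refine Finset.sum_congr rfl fun g _ => ?_
  rw [measureReal_def, PMF.toMeasure_apply_singleton _ _ (measurableSet_singleton _)]

lemma toReal_mem_stdSimplex : (fun g : μ.support => (μ g).toReal) ∈ stdSimplex ℝ μ.support := by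
  refine ⟨fun g => ENNReal.toReal_nonneg, ?_⟩
  have h := integral_toMeasure_eq_sum_support (μ := μ) fun _ => (1 : ℝ)
  simpa only [integral_const, probReal_univ, smul_eq_mul, mul_one] using h.symm

lemma charFun_walkLaw {a : μ.support → RigidMotion} (ha : ∀ g : μ.support, (a g).Represents g)
    (N : ℕ) (R : ℝ) (x : 𝕋) :
    charFun (walkLaw μ N) (R * (x.toCircle : ℂ))
      = (transferOp (fun g : μ.support => (μ g).toReal) a R ^ N) 1 x := by
  induction N generalizing x with
  | zero => rw [charFun_walkLaw_zero, pow_zero, Module.End.one_apply, CircleL2.one_apply]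
  | succ N ih =>
    rw [charFun_walkLaw_succ, integral_toMeasure_eq_sum_support, pow_succ', Module.End.mul_apply,
      transferOp_apply]
    refine Finset.sum_congr rfl fun g _ => ?_
    rw [Complex.real_smul, (ha g).charFun_map, ih]

end FiniteSupport

/-! ### Walks with Diophantine angles -/

lemma eq_one_of_sum_smul_eq_one {ι : Type*} [Fintype ι] {p : ι → ℝ} (hp : p ∈ stdSimplex ℝ ι)
    (hpos : ∀ i, 0 < p i) {z : ι → ℂ} (hz : ∀ i, ‖z i‖ = 1) (h : ∑ i, p i • z i = 1) (i : ι) :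
    z i = 1 := by
  have hre : ∀ i, (z i).re ≤ 1 := fun i => (Complex.re_le_norm _).trans (hz i).le
  have hsum : ∑ i, p i * (1 - (z i).re) = 0 := by
    have hre_sum := congrArg Complex.re h
    simp only [Complex.re_sum, Complex.real_smul, Complex.re_ofReal_mul, Complex.one_re] at hre_sum
    simp_rw [mul_sub, mul_one, Finset.sum_sub_distrib, hre_sum, hp.2, sub_self]
  rw [Finset.sum_eq_zero_iff_of_nonneg fun i _ =>
    mul_nonneg (hpos i).le (sub_nonneg.2 (hre i))] at hsum
  have hre_eq : (z i).re = 1 :=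
    (sub_eq_zero.1 <| (mul_eq_zero_iff_left (hpos i).ne').1 (hsum i (Finset.mem_univ i))).symm
  have him_eq : (z i).im = 0 := (Complex.abs_re_eq_norm).1 (by rw [hre_eq, hz i, abs_one])
  exact Complex.ext hre_eq him_eq

lemma DiophantineAngle.toCircle_sq_ne_one {m α : ℝ} (h : DiophantineAngle m α) :
    (AddCircle.toCircle (α : 𝕋) : ℂ) ^ 2 ≠ 1 := fun hone => by
  obtain ⟨c, hc, M, hM⟩ := h.exists_le_norm_toCircle_pow_sub_one
  have h2 := hM 2 two_pos
  rw [hone, sub_self, norm_zero, zero_mul] at h2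
  exact h2.not_gt hc

/-- The angles of the steps `g i` satisfy the arithmetic hypothesis of the theorem: the difference
of two of them satisfies (D.C.-`m`), or they are all equal to an angle which does. -/
def HasDiophantineAngles {ι : Type*} (m : ℝ) (g : ι → RigidMotion) : Prop :=
  (∃ i j, ∃ α : ℝ, (α : 𝕋) = (g i).angle - (g j).angle ∧ DiophantineAngle m α) ∨
    ∃ α : ℝ, DiophantineAngle m α ∧ ∀ i, (g i).angle = (α : 𝕋)

section Words

variable {ι : Type*} (g : ι → RigidMotion)

lemma exists_mem_range_pow_angle_eq_add_nsmul_sub (i j : ι) {k K : ℕ} (hk : k ≤ K) :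
    ∃ W ∈ Set.range g ^ K,
      W.angle = K • (g j).angle + k • ((g i).angle - (g j).angle) := by
  obtain ⟨l, rfl⟩ := Nat.exists_eq_add_of_le hk
  refine ⟨g i ^ k * g j ^ l, ?_, ?_⟩
  · rw [pow_add]
    exact Set.mul_mem_mul (Set.pow_mem_pow (Set.mem_range_self i))
      (Set.pow_mem_pow (Set.mem_range_self j))
  · rw [RigidMotion.angle_mul, RigidMotion.angle_pow, RigidMotion.angle_pow, add_nsmul, nsmul_sub]
    abel

variable {g}

lemma HasDiophantineAngles.exists_word [Nonempty ι] {m : ℝ} (h : HasDiophantineAngles m g) :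
    ∃ α : ℝ, DiophantineAngle m α ∧ ∀ K : ℕ, ∃ γ : 𝕋, ∀ k ≤ K, ∃ n ≤ K, ∃ W ∈ Set.range g ^ n,
      W.angle = γ + k • (α : 𝕋) := by
  rcases h with ⟨i, j, α, hα, hD⟩ | ⟨α, hD, hα⟩
  · refine ⟨α, hD, fun K => ⟨K • (g j).angle, fun k hk => ⟨K, le_rfl, ?_⟩⟩⟩
    rw [hα]
    exact exists_mem_range_pow_angle_eq_add_nsmul_sub g i j hk
  · obtain ⟨i⟩ := ‹Nonempty ι›
    refine ⟨α, hD, fun K => ⟨0, fun k hk => ⟨k, hk, g i ^ k,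
      Set.pow_mem_pow (Set.mem_range_self i), ?_⟩⟩⟩
    rw [RigidMotion.angle_pow, hα i, zero_add]

lemma HasDiophantineAngles.exists_toCircle_sq_ne_one [Nonempty ι] {m : ℝ}
    (h : HasDiophantineAngles m g) : ∃ i, ((g i).angle.toCircle : ℂ) ^ 2 ≠ 1 := by
  by_contra! hone
  rcases h with ⟨i, j, α, hα, hD⟩ | ⟨α, hD, hα⟩
  · refine hD.toCircle_sq_ne_one ?_
    rw [hα, sub_eq_add_neg, AddCircle.toCircle_add, AddCircle.toCircle_neg, Circle.coe_mul,
      Circle.coe_inv, mul_pow, inv_pow, hone i, hone j, inv_one, mul_one]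
  · obtain ⟨i⟩ := ‹Nonempty ι›
    exact hD.toCircle_sq_ne_one (hα i ▸ hone i)

end Words

section Walk

variable {ι : Type*} [Fintype ι] {p : ι → ℝ} {g : ι → RigidMotion}

lemma exists_trans_mul_ne (hp : p ∈ stdSimplex ℝ ι) (hpos : ∀ i, 0 < p i)
    (hmean : ∑ i, p i • (g i).trans = 0) (hrot : ∃ i, ((g i).angle.toCircle : ℂ) ≠ 1)
    (htrans : ∃ i, (g i).trans ≠ 0) : ∃ i j, (g i * g j).trans ≠ (g j * g i).trans := by
  by_contra! hcomm
  obtain ⟨j, hj⟩ := htrans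
  obtain ⟨i, hi⟩ := hrot
  refine hi (eq_one_of_sum_smul_eq_one (z := fun i => ((g i).angle.toCircle : ℂ)) hp hpos
    (fun i => Circle.norm_coe _) (mul_right_cancel₀ hj ?_) i)
  calc (∑ i, p i • ((g i).angle.toCircle : ℂ)) * (g j).trans
      = ∑ i, p i • (g i * g j).trans := by
        simp only [RigidMotion.trans_mul, smul_add, Finset.sum_add_distrib, hmean, zero_add,
          Finset.sum_mul, smul_mul_assoc]
    _ = ∑ i, p i • (g j * g i).trans := by simp only [hcomm _ j]
    _ = 1 * (g j).trans := by
        simp only [RigidMotion.trans_mul, smul_add, Finset.sum_add_distrib, ← mul_smul_comm,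
          ← Finset.mul_sum, hmean, mul_zero, add_zero, ← Finset.sum_smul, hp.2, one_smul, one_mul]

lemma HasDiophantineAngles.sum_smul_toCircle_sq_ne_one [Nonempty ι] {m : ℝ}
    (h : HasDiophantineAngles m g) (hp : p ∈ stdSimplex ℝ ι) (hpos : ∀ i, 0 < p i) :
    ∑ i, p i • ((g i).angle.toCircle : ℂ) ^ 2 ≠ 1 := fun hsum => by
  obtain ⟨i, hi⟩ := h.exists_toCircle_sq_ne_one
  exact hi (eq_one_of_sum_smul_eq_one (z := fun i => ((g i).angle.toCircle : ℂ) ^ 2) hp hpos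
    (fun i => by rw [norm_pow, Circle.norm_coe, one_pow]) hsum i)

lemma HasDiophantineAngles.exists_isDiophantineWalk {m : ℝ} (h : HasDiophantineAngles m g)
    (hp : p ∈ stdSimplex ℝ ι) (hpos : ∀ i, 0 < p i) (hmean : ∑ i, p i • (g i).trans = 0)
    (htrans : ∃ i, (g i).trans ≠ 0) : ∃ α M, IsDiophantineWalk p g α M := by
  have : Nonempty ι := htrans.nonempty
  obtain ⟨α, hD, hword⟩ := h.exists_word
  obtain ⟨c, hc, M, hM⟩ := hD.exists_le_norm_toCircle_pow_sub_one
  obtain ⟨i, hi⟩ := h.exists_toCircle_sq_ne_one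
  exact ⟨α, M, hp, hpos, hword,
    exists_trans_mul_ne hp hpos hmean ⟨i, fun hone => hi (by rw [hone, one_pow])⟩ htrans,
    c, hc, hM⟩

end Walk

/-! ### The local limit theorem -/

lemma eventually_two_pi_mul_sqrt_le_exp {κ : ℝ} (hκ : 0 < κ) : ∀ᶠ N : ℕ in atTop,
    2 * Real.pi * √N ≤ Real.exp (κ * Real.log N ^ 2) := by
  have hlog : Tendsto (fun N : ℕ => Real.log N) atTop atTop :=
    Real.tendsto_log_atTop.comp tendsto_natCast_atTop_atTop
  set b := Real.log (2 * Real.pi)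
  have hb : 0 ≤ b := Real.log_nonneg (by linarith [Real.pi_gt_three])
  filter_upwards [hlog.eventually_ge_atTop 1, hlog.eventually_ge_atTop ((b + 1 / 2) / κ),
    eventually_ge_atTop 1] with N hL1 hL hN
  have hN0 : (0 : ℝ) < N := by exact_mod_cast hN
  have hexp : 2 * Real.pi * √N = Real.exp (b + Real.log N / 2) := by
    rw [Real.exp_add, Real.exp_log Real.two_pi_pos, ← Real.log_sqrt hN0.le,
      Real.exp_log (Real.sqrt_pos.2 hN0)]
  rw [hexp, Real.exp_le_exp]
  rw [div_le_iff₀' hκ] at hL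
  calc b + Real.log N / 2 ≤ (b + 1 / 2) * Real.log N := by nlinarith
    _ ≤ κ * Real.log N * Real.log N := by gcongr
    _ = κ * Real.log N ^ 2 := by ring

lemma rpow_neg_three_halves_eq {x : ℝ} (hx : 0 < x) : x ^ (-(3 / 2) : ℝ) = 1 / (x * √x) := by
  rw [Real.rpow_neg hx.le, Real.sqrt_eq_rpow, show (3 / 2 : ℝ) = 1 + 1 / 2 by norm_num,
    Real.rpow_add hx, Real.rpow_one, one_div (x * _)]

lemma exists_forall_le_mul_sq_of_eventually {X : Type*} {d : ℕ → X → ℝ → ℝ} {a δ : ℕ → ℝ}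
    (hd : ∀ N x r, d N x r ≤ 1) (ha : ∀ N, 0 ≤ a N) (hδ : ∀ N, 0 < δ N) {C : ℝ} (hC : 0 < C)
    (h : ∀ᶠ N in atTop, ∀ x r, δ N < r → d N x r ≤ C * a N * r ^ 2) :
    ∃ C > 0, ∀ N, 0 < a N → ∀ x r, δ N < r → d N x r ≤ C * a N * r ^ 2 := by
  obtain ⟨N₀, hN₀⟩ := eventually_atTop.1 h
  have hterm : ∀ N, 0 ≤ 1 / (a N * δ N ^ 2) := fun N => by have := ha N; positivity
  have hsum : 0 ≤ ∑ N ∈ Finset.range N₀, 1 / (a N * δ N ^ 2) :=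
    Finset.sum_nonneg fun N _ => hterm N
  refine ⟨C + ∑ N ∈ Finset.range N₀, 1 / (a N * δ N ^ 2), by positivity,
    fun N hN x r hr => ?_⟩
  rw [mul_assoc]
  rcases le_or_gt N₀ N with hNN | hNN
  · refine (hN₀ N hNN x r hr).trans ?_
    rw [mul_assoc]
    gcongr
    exact le_add_of_nonneg_right hsum
  · have hδN := hδ N
    calc d N x r ≤ 1 := hd N x r
      _ = 1 / (a N * δ N ^ 2) * (a N * δ N ^ 2) := by field_simp
      _ ≤ (C + ∑ N ∈ Finset.range N₀, 1 / (a N * δ N ^ 2)) * (a N * r ^ 2) := by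
        gcongr
        exact (Finset.single_le_sum (f := fun N => 1 / (a N * δ N ^ 2)) (fun N _ => hterm N)
          (Finset.mem_range.2 hNN)).trans (le_add_of_nonneg_left hC.le)

lemma exists_eventually_abs_measureReal_ball_sub_scaledGaussian_le {ν : ℕ → Measure ℂ}
    [∀ N, IsProbabilityMeasure (ν N)] {σ κ C : ℝ} (hσ : σ ≠ 0) (hκ : 0 < κ) (hC : 0 < C)
    (h : ∀ᶠ N : ℕ in atTop, ∀ δ, Real.exp (-(κ * Real.log N ^ 2)) ≤ δ →
      charFunDist (ν N) (scaledGaussian (σ * √N)) δ ≤ C / (N * √N)) :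
    ∃ C' > 0, ∀ᶠ N : ℕ in atTop, ∀ (x₀ : ℂ) (r : ℝ), Real.exp (-(κ / 2) * Real.log N ^ 2) < r →
      |(ν N).real (Metric.ball x₀ r)
          - (scaledGaussian (σ * √N)).real (Metric.ball x₀ r)|
        ≤ C' * (N : ℝ) ^ (-(3 / 2) : ℝ) * r ^ 2 := by
  obtain ⟨K, hK, hball⟩ := exists_abs_measureReal_ball_sub_le
  refine ⟨K * (1 / σ ^ 2 + C), by positivity, ?_⟩
  filter_upwards [h, eventually_two_pi_mul_sqrt_le_exp (half_pos hκ), eventually_ge_atTop 4]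
    with N hN hexp hN4 x₀ r hr
  have hN4' : (4 : ℝ) ≤ N := by exact_mod_cast hN4
  have hN0 : (0 : ℝ) < N := by linarith
  have hr0 : 0 < r := (Real.exp_pos _).trans hr
  have hsqrt : 2 ≤ √N := Real.le_sqrt_of_sq_le (by linarith)
  have hfreq : Real.exp (-(κ * Real.log N ^ 2)) ≤ r / √N / (2 * Real.pi) := by
    rw [div_div, le_div_iff₀ (by positivity), mul_comm √(N : ℝ)]
    calc _ ≤ Real.exp (-(κ * Real.log N ^ 2)) * Real.exp (κ / 2 * Real.log N ^ 2) := by gcongr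
      _ = Real.exp (-(κ / 2) * Real.log N ^ 2) := by rw [← Real.exp_add]; ring_nf
      _ ≤ r := hr.le
  have hdens := scaledGaussian_le (s := σ * √N) (by positivity)
  refine (hball _ _ _ (by positivity) hdens x₀ r (r / √N) (by positivity) ?_).trans ?_
  · rw [mul_div_assoc', div_le_iff₀ (by positivity), mul_comm]
    gcongr
  · grw [hN _ hfreq]
    rw [mul_pow, Real.sq_sqrt hN0.le, rpow_neg_three_halves_eq hN0]
    refine le_of_eq ?_
    field_simp

section Walk

variable {μ : PMF (ℂ ≃ᵢ ℂ)} {a : μ.support → RigidMotion}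

lemma hasDiophantineAngles_of_represents (ha : ∀ g : μ.support, (a g).Represents g) {m : ℝ}
    (h : (∃ g₁ ∈ μ.support, ∃ g₂ ∈ μ.support, ∃ θ : ℝ,
        HasRotationAngle (g₁ * g₂⁻¹) θ ∧ DiophantineAngle m θ) ∨
      (∃ θ₀ : ℝ, DiophantineAngle m θ₀ ∧ ∀ g ∈ μ.support, HasRotationAngle g θ₀)) :
    HasDiophantineAngles m a := by
  rcases h with ⟨g₁, h₁, g₂, h₂, θ, hθ, hD⟩ | ⟨θ, hD, hθ⟩
  · refine Or.inl ⟨⟨g₁, h₁⟩, ⟨g₂, h₂⟩, θ, ?_, hD⟩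
    have hmul := hθ.represents.mul (ha ⟨g₂, h₂⟩)
    rw [inv_mul_cancel_right] at hmul
    exact eq_sub_of_add_eq (congrArg RigidMotion.angle (hmul.eq (ha ⟨g₁, h₁⟩)))
  · exact Or.inr ⟨θ, hD, fun g =>
      congrArg RigidMotion.angle ((ha g).eq (hθ g g.2).represents)⟩

lemma walkSigma_sq [Fintype μ.support] (ha : ∀ g : μ.support, (a g).Represents g) :
    walkSigma μ ^ 2 = stepVariance (fun g : μ.support => (μ g).toReal) a := by
  rw [walkSigma, Real.sq_sqrt (mul_nonneg (by norm_num) (integral_nonneg fun g => sq_nonneg _)),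
    integral_toMeasure_eq_sum_support, stepVariance, one_div, inv_mul_eq_div]
  simp only [(ha _).apply_zero, smul_eq_mul]

lemma walkLaw_eq_scaledGaussian_zero [Finite μ.support]
    (ha : ∀ g : μ.support, (a g).Represents g) (htrans : ∀ g, (a g).trans = 0) (N : ℕ) :
    walkLaw μ N = scaledGaussian 0 := by
  have := Fintype.ofFinite μ.support
  refine Measure.ext_of_charFun (funext fun ξ => ?_)
  have hpolar : ξ = ‖ξ‖ * (AddCircle.toCircle (ξ.arg : 𝕋) : ℂ) := by
    rw [toCircle_coe, Circle.coe_exp, Complex.norm_mul_exp_arg_mul_I]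
  have hone : ∀ n : ℕ, (transferOp (fun g : μ.support => (μ g).toReal) a ‖ξ‖ ^ n) 1 = 1 := by
    refine fun n => (Module.End.pow_apply _ _ _).trans (Function.iterate_fixed ?_ n)
    ext x
    simp only [transferOp_apply, htrans, inner_zero_left, mul_zero, Circle.exp_zero,
      Circle.coe_one, CircleL2.one_apply, mul_one, ← Complex.ofReal_sum, toReal_mem_stdSimplex.2,
      Complex.ofReal_one]
  rw [charFun_scaledGaussian, hpolar, charFun_walkLaw ha, hone, CircleL2.one_apply,
    zero_pow two_ne_zero, zero_mul, zero_div, neg_zero, Real.exp_zero, Complex.ofReal_one]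

lemma exists_eventually_charFunDist_le [Fintype μ.support]
    (ha : ∀ g : μ.support, (a g).Represents g) {α : 𝕋} {M : ℕ}
    (h : IsDiophantineWalk (fun g : μ.support => (μ g).toReal) a α M)
    (hmean : ∑ g : μ.support, (μ g).toReal • (a g).trans = 0) (hσ : walkSigma μ ≠ 0)
    (hangle : ∑ g : μ.support, (μ g).toReal • ((a g).angle.toCircle : ℂ) ^ 2 ≠ 1) :
    ∃ κ > 0, ∃ C > 0, ∀ᶠ N : ℕ in atTop, ∀ δ, Real.exp (-(κ * Real.log N ^ 2)) ≤ δ →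
      charFunDist (walkLaw μ N) (scaledGaussian (walkSigma μ * √N)) δ ≤ C / (N * √N) := by
  have hvar := walkSigma_sq ha
  have hvar_pos := hvar ▸ (by positivity : 0 < walkSigma μ ^ 2)
  obtain ⟨C, hC, y₀, hy₀⟩ :=
    h.exists_mul_norm_transferOp_pow_one_sub_le hmean hvar_pos hangle
  obtain ⟨P, hP⟩ : ∃ P, P = 8 * M + 32 := ⟨_, rfl⟩
  rw [← hP] at hy₀
  have hP0 : (0 : ℝ) < P := by rw [hP]; positivity
  have hroot : Tendsto (fun N : ℕ => (N : ℝ) ^ (P : ℝ)⁻¹) atTop atTop :=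
    (tendsto_rpow_atTop (inv_pos.2 hP0)).comp tendsto_natCast_atTop_atTop
  refine ⟨1 / (64 * P ^ 2), by positivity, 2 * Real.pi * C * Real.pi, by positivity, ?_⟩
  filter_upwards [hroot.eventually_ge_atTop y₀, eventually_ge_atTop 1] with N hN hN1 δ hδ
  have hN0 : (0 : ℝ) < N := by exact_mod_cast hN1
  have hscale : Real.exp (-(Real.log ((N : ℝ) ^ (P : ℝ)⁻¹) ^ 2 / 64)) ≤ δ := by
    rw [Real.log_rpow hN0]
    refine le_of_eq_of_le ?_ hδ
    field_simp
  have hpow : (N : ℝ) = ((N : ℝ) ^ (P : ℝ)⁻¹) ^ P :=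
    (Real.rpow_inv_natCast_pow hN0.le (by exact_mod_cast hP0.ne')).symm
  refine (integral_norm_div_le_of_radial_bound (by fun_prop) (fun R _ x => ?_) hC.le hN0
    ((Real.exp_pos _).trans_le hδ) (hy₀ _ hN N hpow δ hscale)).trans_eq (by field_simp)
  rw [charFun_walkLaw ha, charFun_scaledGaussian, norm_mul, Circle.norm_coe, mul_one,
    Complex.norm_real, Real.norm_eq_abs, sq_abs, mul_pow, Real.sq_sqrt hN0.le, hvar,
    CircleL2.sub_apply, CircleL2.smul_apply, CircleL2.one_apply, Complex.real_smul, mul_one]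

theorem exists_abs_walkLaw_real_ball_sub_le [Finite μ.support]
    (ha : ∀ g : μ.support, (a g).Represents g)
    (hmean : ∫ g, g 0 ∂μ.toMeasure = 0) {m : ℝ} (hangle : HasDiophantineAngles m a) :
    ∃ c > 0, ∃ C > 0, ∀ N : ℕ, 1 ≤ N → ∀ (x₀ : ℂ) (r : ℝ), Real.exp (-c * Real.log N ^ 2) < r →
      |(walkLaw μ N).real (Metric.ball x₀ r)
          - (scaledGaussian (walkSigma μ * √N)).real (Metric.ball x₀ r)|
        ≤ C * (N : ℝ) ^ (-(3 / 2) : ℝ) * r ^ 2 := by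
  have := Fintype.ofFinite μ.support
  have hmean' : ∑ g : μ.support, (μ g).toReal • (a g).trans = 0 := by
    simpa only [integral_toMeasure_eq_sum_support, (ha _).apply_zero] using hmean
  have hvar := walkSigma_sq ha
  by_cases htrans : ∃ g, (a g).trans ≠ 0
  · have hσ : walkSigma μ ≠ 0 := by
      obtain ⟨g, hg⟩ := htrans
      rw [← sq_pos_iff, hvar]
      refine half_pos (Finset.sum_pos' (fun g _ => by positivity) ⟨g, Finset.mem_univ _, ?_⟩)
      exact mul_pos (toReal_pos_of_support g) (by positivity)
    have : Nonempty μ.support := htrans.nonempty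
    obtain ⟨α, M, hwalk⟩ := hangle.exists_isDiophantineWalk toReal_mem_stdSimplex
      toReal_pos_of_support hmean' htrans
    obtain ⟨κ, hκ, C, hC, hdist⟩ := exists_eventually_charFunDist_le ha hwalk hmean' hσ
      (hangle.sum_smul_toCircle_sq_ne_one toReal_mem_stdSimplex toReal_pos_of_support)
    obtain ⟨C', hC', hev⟩ :=
      exists_eventually_abs_measureReal_ball_sub_scaledGaussian_le hσ hκ hC hdist
    obtain ⟨C'', hC'', hall⟩ := exists_forall_le_mul_sq_of_eventually
      (fun N x r => abs_sub_le_of_nonneg_of_le measureReal_nonneg measureReal_le_one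
        measureReal_nonneg measureReal_le_one)
      (fun N => by positivity) (fun N => Real.exp_pos _) hC' hev
    exact ⟨κ / 2, half_pos hκ, C'', hC'', fun N hN => hall N (by positivity)⟩
  · push Not at htrans
    have hσ : walkSigma μ = 0 := by
      rw [← sq_eq_zero_iff, hvar]
      simp [stepVariance, htrans]
    refine ⟨1, one_pos, 1, one_pos, fun N _ x₀ r _ => ?_⟩
    rw [walkLaw_eq_scaledGaussian_zero ha htrans, hσ, zero_mul, sub_self, abs_zero]
    positivity

end Walk

lemma localCLTToScale_of_abs_sub_le {μ : PMF (ℂ ≃ᵢ ℂ)} {γ : ℕ → Measure ℂ}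
    (hγ : ∀ N, IsGaussian (γ N)) {δ : ℕ → ℝ} {C : ℝ}
    (h : ∀ N : ℕ, 1 ≤ N → ∀ (x₀ : ℂ) (r : ℝ), δ N < r →
      |walkProb μ N (Metric.ball x₀ r) - (γ N).real (Metric.ball x₀ r)|
        ≤ C * (N : ℝ) ^ (-(3 / 2) : ℝ) * r ^ 2) : LocalCLTToScale μ δ := by
  refine ⟨γ, hγ, fun ε hε => ?_⟩
  have hsqrt : Tendsto (fun N : ℕ => √(N : ℝ)) atTop atTop :=
    Real.tendsto_sqrt_atTop.comp tendsto_natCast_atTop_atTop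
  filter_upwards [hsqrt.eventually_ge_atTop (C / ε), eventually_ge_atTop 1] with N hN hN1 x₀ r hr
  have hN0 : (0 : ℝ) < N := by exact_mod_cast hN1
  rw [div_le_iff₀' hε] at hN
  refine (h N hN1 x₀ r hr).trans ?_
  rw [rpow_neg_three_halves_eq hN0]
  calc C * (1 / (N * √N)) * r ^ 2 ≤ ε * √N * (1 / (N * √N)) * r ^ 2 := by gcongr
    _ = ε * ((N : ℝ)⁻¹ * r ^ 2) := by field_simp

theorem theorem1 (μ : PMF (ℂ ≃ᵢ ℂ)) (hfin : μ.support.Finite)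
    (hrot : ∀ g ∈ μ.support, ∃ θ : ℝ, HasRotationAngle g θ)
    (hmean : ∫ g, g 0 ∂μ.toMeasure = 0)
    (m : ℝ) (hm : 0 < m)
    (hdioph :
      (∃ g₁ ∈ μ.support, ∃ g₂ ∈ μ.support, ∃ θ : ℝ,
        HasRotationAngle (g₁ * g₂⁻¹) θ ∧ DiophantineAngle m θ) ∨
      (∃ θ₀ : ℝ, DiophantineAngle m θ₀ ∧ ∀ g ∈ μ.support, HasRotationAngle g θ₀)) :
    ∃ c : ℝ, 0 < c ∧
      LocalCLTToScale μ (fun N => Real.exp (-c * Real.log N ^ 2)) ∧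
      ∃ C : ℝ, 0 < C ∧ ∀ N : ℕ, 1 ≤ N → ∀ (x₀ : ℂ) (r : ℝ),
        Real.exp (-c * Real.log N ^ 2) < r →
        |walkProb μ N (Metric.ball x₀ r)
            - (stdGaussian ℂ).real {z | ((walkSigma μ * Real.sqrt N : ℝ) : ℂ) * z
                ∈ Metric.ball x₀ r}|
          ≤ C * (N : ℝ) ^ (-(3 / 2) : ℝ) * r ^ 2 := by
  have := hfin.to_subtype
  choose θ hθ using fun g : μ.support => hrot g g.2
  have hrep : ∀ g : μ.support, RigidMotion.Represents ⟨θ g, (g : ℂ ≃ᵢ ℂ) 0⟩ g :=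
    fun g => (hθ g).represents
  obtain ⟨c, hc, C, hC, hbound⟩ := exists_abs_walkLaw_real_ball_sub_le hrep hmean
    (hasDiophantineAngles_of_represents hrep hdioph)
  simp only [← walkProb_eq_walkLaw_real μ _ measurableSet_ball] at hbound
  refine ⟨c, hc, localCLTToScale_of_abs_sub_le
    (γ := fun N => scaledGaussian (walkSigma μ * √N)) (fun N => inferInstance) hbound,
    C, hC, fun N hN x₀ r hr => ?_⟩
  rw [stdGaussian_real_mul_mem _ measurableSet_ball]
  exact hbound N hN x₀ r hr
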